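/- Let $R$ be a commutative ring. For a sequence $(s_n)_{n\ge 0}$ in $R$ let $h_n=\det(s_{i+j})_{0\le i,j\le n}$ be its Hankel transform, and for $r\in R$ let its $r$-th binomial transform be $n\mapsto\sum_{k=0}^n\binom nk r^{n-k}s_k$. A sequence $(h_n)$ is an $(r,s)$ Somos-4 sequence if $h_nh_{n-4}=r\,h_{n-1}h_{n-3}+s\,h_{n-2}^2$ for all $n\ge 4$. Let $C(x)=\sum_n C_nx^n$ be the generating function of the Catalan numbers and, for $\alpha,\beta,\gamma,\delta\in R$, let $$g_{\alpha,\beta,\gamma,\delta}(x)=\frac{1+\gamma x}{1-\alpha x-\beta x^2}\,C\!\left(\frac{\delta x^3(1+\gamma x)}{(1-\alpha x-\beta x^2)^2}\right)\in R[[x]].$$ **(0)** Every binomial transform leaves the Hankel transform of a sequence unchanged. **(1)** Let $a,b,c\in R$ and let $E$ be the Weierstrass curve $y^2-axy-y=x^3-bx^2-cx$, with $P=(0,0)\in E$. Put $\alpha=2(c-1)-a$, $\beta=a(c-1)-b-(c-1)^2$, $\gamma=a-2c+1$. Let $u_n$ be the coefficients of $g_{\alpha,\beta,\gamma,1}$ and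 $v_n$ those of $g_{a-2c,\,ac-b-c^2,\,0,\,1}$. * There is a unique power series $Y\in R[[x]]$ with $Y(0)=0$ that solves the equation of $E$ for $y$, and the unique reversion of $\dfrac{x}{1-x-(Y-cx)}$ is $x\,g_{\alpha,\beta,\gamma,1}(x)$. * One has $$u_n=\sum_{k=0}^n\sum_{j=0}^{k+1}\binom{k+1}{j}\gamma^j\sum_{i=0}^{n-3k-j}\binom{2k+i}{i}\binom{i}{n-3k-i-j}\alpha^{2i+3k+j-n}\beta^{n-3k-i-j}C_k,$$ $$v_n=\sum_{k=0}^n\sum_{j=0}^{n-3k}\binom{2k+j}{j}\binom{j}{n-3k-j}(ac-b-c^2)^{n-3k-j}(a-2c)^{2j-n+3k}C_k,$$ and $v$ is the $(a-2c+1)$-th binomial transform of $u$. Moreover $u_n$ and $v_n$ are the entries $t_{n,0}$ of the lattice path arrays of (2) for the parameters $(\alpha,\beta,\gamma,1)$ and $(a-2c,\,ac-b-c^2,\,0,\,1)$ respectively. * $u$ and $v$ have the same Hankel transform $(h_n)$. It begins $h_0=1$, $h_1=ac-b-c^2$, $h_2=a^2c-a(b+3c^2)+2bc+2c^3-1$,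 and it is a $(1,\,-ac+b+c^2)$ Somos-4 sequence. * It coincides, up to a shift by two and signs, with the elliptic divisibility sequence of $E$ at $P$: if $\psi_n$ denotes the $n$-th division polynomial of $E$, then $h_n=(-1)^{n+1}\psi_{n+2}(P)$ for all $n\ge 0$. **(2)** Let $\alpha,\beta,\gamma,\delta\in R$ and $g=g_{\alpha,\beta,\gamma,\delta}$. Let $t_{n,k}$ be the array with $t_{n,k}=0$ for $n<0$ or $k<0$, $t_{0,0}=1$, $t_{1,0}=\alpha+\gamma$, and, for all other $n,k\ge 0$, $$t_{n,k}=t_{n-1,k-1}+\gamma t_{n-2,k-1}+\alpha t_{n-1,k}+\beta t_{n-2,k}+\delta t_{n-2,k+1}.$$ Then $xg(x)$ is the unique power series $u$ with $u=x(1+\gamma x+\alpha u+\beta ux+\delta u^2x)$; $(t_{n,k})$ is the Riordan array $(g(x),xg(x))$, i.e. $t_{n,k}=[x^n]\,g(x)(xg(x))^k$; and the Hankel transform of the coefficient sequence $(t_{n,0})$ of $g$ is a $(\delta^2,\ \delta^2(\alpha\gamma-\beta+\gamma^2))$ Somos-4 sequence. -/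

import Mathlib

open PowerSeries

/-- The Hankel transform of `u`: the sequence of determinants `h_n = det (u_{i+j})_{0 ≤ i,j ≤ n}`. -/
def hankelTransform {R : Type*} [CommRing R] (u : ℕ → R) (n : ℕ) : R :=
  Matrix.det (Matrix.of fun i j : Fin (n + 1) => u ((i : ℕ) + (j : ℕ)))

/-- An `(r, s)` Somos-4 sequence. The recurrence `h_n = (r h_{n-1} h_{n-3} + s h_{n-2}^2) / h_{n-4}`
is written without division, so that it also makes sense when some term vanishes. -/
def IsSomosFour {R : Type*} [CommRing R] (r s : R) (h : ℕ → R) : Prop :=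
  ∀ n : ℕ, h (n + 4) * h n = r * (h (n + 3) * h (n + 1)) + s * h (n + 2) ^ 2

/-- The `r`-th binomial transform `n ↦ ∑_{k ≤ n} binom(n,k) r^{n-k} u_k`; on generating functions
it is `g(x) ↦ g(x / (1 - r x)) / (1 - r x)`. -/
def binomialTransform {R : Type*} [CommRing R] (r : R) (u : ℕ → R) (n : ℕ) : R :=
  ∑ k ∈ Finset.range (n + 1), (Nat.choose n k : R) * r ^ (n - k) * u k

/-- The signed lattice path array `t_{n,k}`, `n, k ≥ 0`:
`t_{n,k} = t_{n-1,k-1} + γ t_{n-2,k-1} + α t_{n-1,k} + β t_{n-2,k} + δ t_{n-2,k+1}`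
with `t_{n,k} = 0` for `n < 0` or `k < 0`, `t_{0,0} = 1` and `t_{1,0} = α + γ`.
It enumerates the paths from `(0,0)` to `(n,k)` in the quadrant, classified by their last step, with
step set `(1,1), γ*(2,1), α*(1,0), β*(2,0), δ*(2,-1)`, an initial horizontal step `(1,0)` from the
origin having multiplicity `α + γ`. -/
def pathArray {R : Type*} [CommRing R] (α β γ δ : R) : ℕ → ℕ → R
  | 0, 0 => 1
  | 0, _ + 1 => 0
  | 1, 0 => α + γ
  | 1, 1 => 1
  | 1, _ + 2 => 0
  | n + 2, 0 =>
      α * pathArray α β γ δ (n + 1) 0 + β * pathArray α β γ δ n 0 + δ * pathArray α β γ δ n 1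
  | n + 2, k + 1 =>
      pathArray α β γ δ (n + 1) k + γ * pathArray α β γ δ n k
        + α * pathArray α β γ δ (n + 1) (k + 1) + β * pathArray α β γ δ n (k + 1)
        + δ * pathArray α β γ δ n (k + 2)

/-- The generating function `∑ C_n x^n` of the Catalan numbers, with coefficients in `R`. -/
noncomputable def catalanGF (R : Type*) [CommRing R] : R⟦X⟧ :=
  PowerSeries.mk fun n => (catalan n : R)

/-- `1 / (1 - α x - β x^2)` as a power series. -/
noncomputable def quadInv {R : Type*} [CommRing R] (α β : R) : R⟦X⟧ :=
  PowerSeries.invOfUnit (1 - C α * X - C β * X ^ 2) 1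

/-- The generating function
`g(x) = (1 + γ x) / (1 - α x - β x^2) * C(δ x^3 (1 + γ x) / (1 - α x - β x^2)^2)`,
where `C(x)` is the generating function of the Catalan numbers. -/
noncomputable def pathSeries {R : Type*} [CommRing R] (α β γ δ : R) : R⟦X⟧ :=
  (1 + C γ * X) * quadInv α β *
    (catalanGF R).subst (C δ * X ^ 3 * (1 + C γ * X) * quadInv α β ^ 2)

/-- `f` is the (compositional) reversion of `F`: `f(0) = 0` and `F(f(x)) = x`. -/
def IsReversion {R : Type*} [CommRing R] (F f : R⟦X⟧) : Prop :=
  PowerSeries.constantCoeff f = 0 ∧ F.subst f = (X : R⟦X⟧)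

/-- The curve `y^2 - a x y - y = x^3 - b x^2 - c x`. -/
def somosCurve {R : Type*} [CommRing R] (a b c : R) : WeierstrassCurve R :=
  { a₁ := -a, a₂ := -b, a₃ := -1, a₄ := -c, a₆ := 0 }

/-- The elliptic divisibility sequence of `W` at the point `(x, y)`: the values there of the
division polynomials of `W`. -/
noncomputable def ellipticDivisibilitySeq {R : Type*} [CommRing R] (W : WeierstrassCurve R)
    (x y : R) (n : ℤ) : R :=
  (W.ψ n).evalEval x y

/-- `Y` is the expansion at `x = 0` of the branch through `(0,0)` of the solutions for `y` of
`y^2 - a x y - y = x^3 - b x^2 - c x`, that is, of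
`(1 + a x - √(1 + 2 (a - 2 c) x + (a^2 - 4 b) x^2 + 4 x^3)) / 2`. -/
def IsCurveBranch {R : Type*} [CommRing R] (a b c : R) (Y : R⟦X⟧) : Prop :=
  PowerSeries.constantCoeff Y = 0 ∧
    Y ^ 2 - C a * X * Y - Y = X ^ 3 - C b * X ^ 2 - C c * X

/-- The series `x / (1 - x - (Y - c x))`, which is `x / (1 - x - x^2 ((Y - c x) / x^2))`. -/
noncomputable def branchTransform {R : Type*} [CommRing R] (c : R) (Y : R⟦X⟧) : R⟦X⟧ :=
  X * PowerSeries.invOfUnit (1 - X - (Y - C c * X)) 1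

/-- The generating function `g(x)` of `u_n`. -/
noncomputable def uSeries {R : Type*} [CommRing R] (a b c : R) : R⟦X⟧ :=
  pathSeries (2 * (c - 1) - a) (a * (c - 1) - b - (c - 1) ^ 2) (a - 2 * c + 1) 1

/-- The generating function of `v_n`. -/
noncomputable def vSeries {R : Type*} [CommRing R] (a b c : R) : R⟦X⟧ :=
  pathSeries (a - 2 * c) (a * c - b - c ^ 2) 0 1

/-- The sequence `u_n`. -/
noncomputable def uSeq {R : Type*} [CommRing R] (a b c : R) (n : ℕ) : R :=
  PowerSeries.coeff n (uSeries a b c)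

/-- The sequence `v_n`. -/
noncomputable def vSeq {R : Type*} [CommRing R] (a b c : R) (n : ℕ) : R :=
  PowerSeries.coeff n (vSeries a b c)

/-- `∑_{k=0}^n ∑_{j=0}^{k+1} binom(k+1,j) γ^j ∑_{i=0}^{n-3k-j} binom(2k+i,i) binom(i,n-3k-j-i)
α^{2i+3k+j-n} β^{n-3k-j-i} C_k`, the inner sum being empty when `n < 3k + j`. Whenever the
exponent of `α` is negative the binomial coefficient in front of it vanishes. -/
def uFormula {R : Type*} [CommRing R] (α β γ : R) (n : ℕ) : R :=
  ∑ k ∈ Finset.range (n + 1), ∑ j ∈ Finset.range (k + 2),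
    if 3 * k + j ≤ n then
      (Nat.choose (k + 1) j : R) * γ ^ j *
        ∑ i ∈ Finset.range (n - 3 * k - j + 1),
          (Nat.choose (2 * k + i) i : R) * (Nat.choose i (n - 3 * k - j - i) : R) *
            α ^ (2 * i + 3 * k + j - n) * β ^ (n - 3 * k - j - i) * (catalan k : R)
    else 0

/-- `∑_{k=0}^n ∑_{j=0}^{n-3k} binom(2k+j,j) binom(j,n-3k-j) q^{n-3k-j} p^{2j-n+3k} C_k`, the inner
sum being empty when `n < 3k`. Whenever the exponent of `p` is negative the binomial coefficient in
front of it vanishes. -/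
def vFormula {R : Type*} [CommRing R] (p q : R) (n : ℕ) : R :=
  ∑ k ∈ Finset.range (n + 1),
    if 3 * k ≤ n then
      ∑ j ∈ Finset.range (n - 3 * k + 1),
        (Nat.choose (2 * k + j) j : R) * (Nat.choose j (n - 3 * k - j) : R) *
          q ^ (n - 3 * k - j) * p ^ (2 * j + 3 * k - n) * (catalan k : R)
    else 0

/-! Everything about `g` comes from its quadratic equation, whose power series solution is unique
(`eq_of_quadratic`). The Riordan array, the reversion and the effect of binomial transforms all
reduce to checking this equation. The `γ`-th binomial transform turns `(α, β, γ, δ)` into `(p, q, 0,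
δ)` with `p = α + 2γ`, `q = β - αγ - γ²`, so Hankel transforms need only be studied for `γ = 0`.

There `g` has a continued fraction whose tails form one family `tailSeries p q δ b w`
(`tailSeries_step`). Each step splits a power of a partial numerator off the Hankel determinant, so
`h (n+2) h n = b (n+2) h (n+1)²`. The pairs `(b k, w k)` satisfy `b k b (k+1) = -δ w k` and `b (k+1)
= q + w k w (k+1)`; hence `b k b (k+1)² b (k+2) = δ² (b (k+1) - q)`, which is the Somos-4 relation
in terms of ratios of the `h n`.

For `p = a - 2c`, `q = ac - b - c²`, `δ = 1`, the same recursion is repeated addition of `P`: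
`(k+1)P` has `x`-coordinate `-b k`, and the line joining it to `P` has slope `c - w k`
(`exists_nsmul_eq_some`). The addition law gives Ward's identity `W (m+n) W (m-n) = (x n - x m) W m²
W n²` for the signed, shifted Hankel sequence, and this forces the recursion of `normEDS`.

The divisions require all `h n` to be nonzero. Both identities are therefore proved in the fraction
field of a polynomial ring over `ℤ`, where a real specialization shows nonvanishing, and then mapped
to `R`. -/

/-! ### The quadratic equation of `g` and the Riordan array -/

lemma catalanGF_eq_one_add {R : Type*} [CommRing R] :
    catalanGF R = 1 + X * catalanGF R ^ 2 := by
  have h : catalanGF R = PowerSeries.map (Nat.castRingHom R) catalanSeries := by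
    ext n; simp [catalanGF, catalanSeries]
  have h2 := congrArg (PowerSeries.map (Nat.castRingHom R)) catalanSeries_sq_mul_X_add_one
  simp only [map_add, map_mul, map_pow, map_X, map_one, ← h] at h2
  linear_combination -h2

lemma catalanGF_subst_eq {R : Type*} [CommRing R] {z : R⟦X⟧} (hz : constantCoeff z = 0) :
    (catalanGF R).subst z = 1 + z * (catalanGF R).subst z ^ 2 := by
  have hs : HasSubst z := HasSubst.of_constantCoeff_zero' hz
  conv_lhs => rw [catalanGF_eq_one_add]
  rw [← coe_substAlgHom hs]
  simp only [map_add, map_one, map_mul, map_pow, substAlgHom_X]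

/-- The solution of `D g = N + t g ^ 2` by means of the Catalan series. -/
lemma mul_catalanGF_subst_eq {R : Type*} [CommRing R] {D Q N t : R⟦X⟧} (hQ : D * Q = 1)
    (ht : constantCoeff t = 0) :
    D * (N * Q * (catalanGF R).subst (t * N * Q ^ 2)) =
      N + t * (N * Q * (catalanGF R).subst (t * N * Q ^ 2)) ^ 2 := by
  have h := catalanGF_subst_eq (z := t * N * Q ^ 2) (by simp [ht])
  generalize (catalanGF R).subst (t * N * Q ^ 2) = c at h ⊢
  linear_combination N * c * hQ + N * h

/-- Subtracting the equations gives `(D - t (g + g')) (g - g') = 0`, and the first factor is a unit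
because `t` has no constant term. -/
lemma eq_of_quadratic {R : Type*} [CommRing R] {D N t g g' : R⟦X⟧}
    (hD : IsUnit (constantCoeff D)) (ht : constantCoeff t = 0)
    (hg : D * g = N + t * g ^ 2) (hg' : D * g' = N + t * g' ^ 2) : g = g' := by
  have hu : IsUnit (D - t * (g + g')) := by
    rw [isUnit_iff_constantCoeff]; simpa [ht] using hD
  have : (D - t * (g + g')) * (g - g') = 0 := by linear_combination hg - hg'
  exact sub_eq_zero.mp ((hu.mul_right_eq_zero).mp this)

lemma quadInv_spec {R : Type*} [CommRing R] (α β : R) :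
    (1 - C α * X - C β * X ^ 2) * quadInv α β = 1 :=
  mul_invOfUnit _ _ (by simp)

lemma pathSeries_eq {R : Type*} [CommRing R] (α β γ δ : R) :
    pathSeries α β γ δ = 1 + C γ * X + C α * X * pathSeries α β γ δ
      + C β * X ^ 2 * pathSeries α β γ δ + C δ * X ^ 3 * pathSeries α β γ δ ^ 2 := by
  have h := mul_catalanGF_subst_eq (N := 1 + C γ * X) (t := C δ * X ^ 3)
    (quadInv_spec α β) (by simp)
  change _ * pathSeries α β γ δ = _ + _ * pathSeries α β γ δ ^ 2 at h
  linear_combination h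

lemma eq_pathSeries {R : Type*} [CommRing R] {α β γ δ : R} {g : R⟦X⟧}
    (h : g = 1 + C γ * X + C α * X * g + C β * X ^ 2 * g + C δ * X ^ 3 * g ^ 2) :
    g = pathSeries α β γ δ := by
  refine eq_of_quadratic (D := 1 - C α * X - C β * X ^ 2) (N := 1 + C γ * X)
    (t := C δ * X ^ 3) (by simp) (by simp) ?_ ?_
  · linear_combination h
  · linear_combination pathSeries_eq α β γ δ

lemma eq_X_mul_pathSeries_iff {R : Type*} [CommRing R] (α β γ δ : R) (f : R⟦X⟧) :
    f = X * (1 + C γ * X + C α * f + C β * f * X + C δ * f ^ 2 * X) ↔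
      f = X * pathSeries α β γ δ := by
  constructor
  · intro h
    set g : R⟦X⟧ := 1 + C γ * X + C α * f + C β * f * X + C δ * f ^ 2 * X with hg
    rw [h]
    congr 1
    apply eq_pathSeries
    rw [h] at hg
    linear_combination hg
  · rintro rfl
    linear_combination X * pathSeries_eq α β γ δ

/-- The equation of `g` multiplied by `x g (x g)^k` is the recurrence for column `k + 1`. In column
`0` the inhomogeneous term `1 + γ x` accounts for the exceptional value `α + γ`. -/
lemma pathArray_eq_coeff {R : Type*} [CommRing R] (α β γ δ : R) (n k : ℕ) :
    pathArray α β γ δ n k =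
      coeff n (pathSeries α β γ δ * (X * pathSeries α β γ δ) ^ k) := by
  set g := pathSeries α β γ δ with hg
  have hge : g = 1 + C γ * X + C α * X * g + C β * X ^ 2 * g + C δ * X ^ 3 * g ^ 2 :=
    pathSeries_eq α β γ δ
  set G : ℕ → R⟦X⟧ := fun k => g * (X * g) ^ k with hG
  have h0 : G 0 = 1 + C γ * X + X * (C α * G 0 + X * (C β * G 0 + C δ * G 1)) := by
    simp only [hG]; linear_combination hge
  have hs (k : ℕ) : G (k + 1) = X * (G k + C α * G (k + 1) + X * (C γ * G k
      + C β * G (k + 1) + C δ * G (k + 2))) := by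
    simp only [hG]; linear_combination X * g * (X * g) ^ k * hge
  change _ = coeff n (G k)
  clear_value G
  clear hge hG hg
  clear_value g
  have cX (n : ℕ) (f : R⟦X⟧) : coeff (n + 1) (X * f) = coeff n f := by
    rw [mul_comm, coeff_succ_mul_X]
  have c0 (f : R⟦X⟧) : coeff 0 (X * f) = 0 := by simp
  induction n using Nat.strong_induction_on generalizing k with
  | _ n ih =>
  match n, k, ih with
  | 0, 0, _ => rw [h0]; simp [pathArray]
  | 0, k + 1, _ => rw [hs, c0, pathArray]
  | 1, 0, ih =>
    have e := ih 0 (by norm_num) 0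
    rw [h0]
    simp only [map_add, cX (n := 0), ← e, coeff_C_mul, coeff_one, coeff_X, c0]
    simp [pathArray]; ring
  | 1, 1, ih =>
    have e := ih 0 (by norm_num) 0
    have e1 := ih 0 (by norm_num) 1
    rw [hs]
    simp only [map_add, cX (n := 0), ← e, ← e1, coeff_C_mul, c0]
    simp [pathArray]
  | 1, k + 2, ih =>
    have e := ih 0 (by norm_num) (k + 1)
    have e1 := ih 0 (by norm_num) (k + 2)
    rw [hs]
    simp only [map_add, cX (n := 0), ← e, ← e1, coeff_C_mul, c0]
    simp [pathArray]
  | n + 2, 0, ih =>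
    have e := ih n (by omega)
    have e1 := ih (n + 1) (by omega)
    rw [h0]
    simp only [map_add, cX, ← e, ← e1, coeff_C_mul, coeff_one, coeff_X, pathArray]
    simp; ring
  | n + 2, k + 1, ih =>
    have e := ih n (by omega)
    have e1 := ih (n + 1) (by omega)
    rw [hs]
    simp only [map_add, cX, ← e, ← e1, coeff_C_mul, pathArray]
    ring

/-! ### Explicit coefficient formulas -/

lemma coeff_pow_eq_zero_of_lt {R : Type*} [CommRing R] {z : R⟦X⟧} (hz : constantCoeff z = 0)
    {j k : ℕ} (h : j < k) : coeff j (z ^ k) = 0 := by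
  obtain ⟨w, rfl⟩ := X_dvd_iff.mpr hz
  rw [mul_pow, coeff_X_pow_mul', if_neg (by omega)]

lemma coeff_subst_eq_sum {R : Type*} [CommRing R] {z : R⟦X⟧} (hz : constantCoeff z = 0)
    (f : R⟦X⟧) {n N : ℕ} (h : n < N) :
    coeff n (f.subst z) = ∑ k ∈ Finset.range N, coeff k f * coeff n (z ^ k) := by
  rw [coeff_subst' (HasSubst.of_constantCoeff_zero' hz)]
  simp only [smul_eq_mul]
  apply finsum_eq_sum_of_support_subset
  intro k hk
  simp only [Function.mem_support] at hk
  simp only [Finset.coe_range, Set.mem_Iio]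
  by_contra hc
  exact hk (by rw [coeff_pow_eq_zero_of_lt hz (by omega), mul_zero])

lemma coeff_mul_subst_eq_sum {R : Type*} [CommRing R] {z : R⟦X⟧} (hz : constantCoeff z = 0)
    (P f : R⟦X⟧) (n : ℕ) :
    coeff n (P * f.subst z) =
      ∑ k ∈ Finset.range (n + 1), coeff k f * coeff n (P * z ^ k) := by
  simp only [coeff_mul, Finset.mul_sum]
  rw [Finset.sum_comm]
  refine Finset.sum_congr rfl fun x hx => ?_
  have := Finset.HasAntidiagonal.mem_antidiagonal.mp hx
  rw [coeff_subst_eq_sum hz f (N := n + 1) (by omega), Finset.mul_sum]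
  exact Finset.sum_congr rfl fun k _ => by ring

/-- Substitute `w` into the expansion of `(1 - x)^(-(d+1))`; terms with `i > n` do not contribute
because `w` has no constant term. -/
lemma coeff_inv_pow {R : Type*} [CommRing R] {w Q : R⟦X⟧} (hw : constantCoeff w = 0)
    (hQ : (1 - w) * Q = 1) (d n : ℕ) :
    coeff n (Q ^ (d + 1)) =
      ∑ i ∈ Finset.range (n + 1), (Nat.choose (d + i) d : R) * coeff n (w ^ i) := by
  have hs : HasSubst w := HasSubst.of_constantCoeff_zero' hw
  have h := congrArg (substAlgHom hs) (mk_add_choose_mul_one_sub_pow_eq_one R d)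
  simp only [map_mul, map_pow, map_sub, map_one, substAlgHom_X] at h
  rw [coe_substAlgHom] at h
  have hq : Q ^ (d + 1) = (mk fun n => (Nat.choose (d + n) d : R) : R⟦X⟧).subst w := by
    have h2 : (1 - w) ^ (d + 1) * Q ^ (d + 1) = 1 := by rw [← mul_pow, hQ, one_pow]
    linear_combination (-Q ^ (d + 1)) * h +
      ((mk fun n => (Nat.choose (d + n) d : R) : R⟦X⟧).subst w) * h2
  rw [hq, coeff_subst_eq_sum hw _ (Nat.lt_succ_self n)]
  simp

lemma coeff_C_add_C_mul_X_pow {R : Type*} [CommRing R] (a b : R) (i l : ℕ) :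
    coeff l ((C a + C b * X) ^ i : R⟦X⟧) = (Nat.choose i l : R) * a ^ (i - l) * b ^ l := by
  rw [add_comm, add_pow, map_sum]
  have (m : ℕ) : coeff l ((C b * X) ^ m * C a ^ (i - m) * (Nat.choose i m : R⟦X⟧)) =
      if l = m then (Nat.choose i l : R) * a ^ (i - l) * b ^ l else 0 := by
    have : (C b * X) ^ m * C a ^ (i - m) * (Nat.choose i m : R⟦X⟧) =
        C (b ^ m * a ^ (i - m) * (Nat.choose i m : R)) * X ^ m := by
      simp only [map_mul, map_pow, map_natCast]; ring
    rw [this, coeff_C_mul, coeff_X_pow]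
    split_ifs with h
    · subst h; ring
    · simp
  simp only [this]
  rw [Finset.sum_ite_eq]
  split_ifs with h
  · rfl
  · rw [Nat.choose_eq_zero_of_lt (by simpa using h)]; simp

lemma coeff_quadInv_pow {R : Type*} [CommRing R] (α β : R) (d m : ℕ) :
    coeff m (quadInv α β ^ (d + 1)) =
      ∑ i ∈ Finset.range (m + 1), (Nat.choose (d + i) i : R) * (Nat.choose i (m - i) : R) *
        α ^ (2 * i - m) * β ^ (m - i) := by
  rw [coeff_inv_pow (w := X * (C α + C β * X)) (by simp)
    (by linear_combination quadInv_spec α β)]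
  refine Finset.sum_congr rfl fun i hi => ?_
  have hi' : i ≤ m := by simpa [Nat.lt_succ_iff] using hi
  rw [mul_pow, coeff_X_pow_mul', if_pos hi', coeff_C_add_C_mul_X_pow, Nat.choose_symm_add]
  rw [show i - (m - i) = 2 * i - m by omega]
  ring

/-- The `k`-th Catalan term is `C_k x^(3k) (1 + γ x)^(k+1) Q^(2k+1)` with `Q = quadInv α β`; expand
both powers. -/
lemma coeff_pathSeries_one {R : Type*} [CommRing R] (α β γ : R) (n : ℕ) :
    coeff n (pathSeries α β γ 1) = uFormula α β γ n := by
  rw [pathSeries, coeff_mul_subst_eq_sum (by simp), uFormula]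
  refine Finset.sum_congr rfl fun k _ => ?_
  have e : (1 + C γ * X) * quadInv α β *
      (C 1 * X ^ 3 * (1 + C γ * X) * quadInv α β ^ 2) ^ k =
      ∑ j ∈ Finset.range (k + 2), C ((Nat.choose (k + 1) j : R) * γ ^ j) *
        (X ^ (3 * k + j) * quadInv α β ^ (2 * k + 1)) := by
    calc _ = (C γ * X + 1) ^ (k + 1) * (X ^ (3 * k) * quadInv α β ^ (2 * k + 1)) := by
          rw [map_one, one_mul, mul_pow, mul_pow, ← pow_mul, ← pow_mul, add_comm 1]; ring
      _ = _ := by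
          rw [add_pow, Finset.sum_mul]
          refine Finset.sum_congr rfl fun j _ => ?_
          simp only [map_mul, map_pow, map_natCast, one_pow]
          ring
  rw [e, map_sum, Finset.mul_sum]
  refine Finset.sum_congr rfl fun j _ => ?_
  rw [coeff_C_mul, coeff_X_pow_mul']
  split_ifs with h
  · rw [coeff_quadInv_pow, Nat.sub_sub]
    simp only [catalanGF, coeff_mk, Finset.mul_sum]
    refine Finset.sum_congr rfl fun i _ => ?_
    rw [show 2 * i + 3 * k + j - n = 2 * i - (n - (3 * k + j)) by omega]
    ring
  · simp

lemma uFormula_zero {R : Type*} [CommRing R] (p q : R) (n : ℕ) :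
    uFormula p q 0 n = vFormula p q n := by
  rw [uFormula, vFormula]
  refine Finset.sum_congr rfl fun k _ => ?_
  rw [Finset.sum_eq_single 0]
  · simp only [add_zero, Nat.choose_zero_right, Nat.sub_zero, pow_zero, Nat.cast_one, one_mul]
    split_ifs
    · exact Finset.sum_congr rfl fun i _ => by ring
    · rfl
  · intro j _ hj
    simp [hj]
  · simp

/-! ### Binomial transforms and Hankel determinants -/

lemma mk_binomialTransform {R : Type*} [CommRing R] (r : R) (f S : R⟦X⟧)
    (hS : (1 - C r * X) * S = 1) :
    (mk (binomialTransform r fun n => coeff n f) : R⟦X⟧) = S * f.subst (X * S) := by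
  ext n
  rw [coeff_mul_subst_eq_sum (by simp), coeff_mk, binomialTransform]
  refine Finset.sum_congr rfl fun k hk => ?_
  have hk' : k ≤ n := by simpa [Nat.lt_succ_iff] using hk
  rw [show S * (X * S) ^ k = X ^ k * S ^ (k + 1) by ring, coeff_X_pow_mul', if_pos hk',
    coeff_inv_pow (w := C r * X) (by simp) hS]
  rw [Finset.sum_eq_single (n - k)]
  · rw [mul_pow, ← map_pow, coeff_C_mul, coeff_X_pow, if_pos rfl,
      show k + (n - k) = n by omega]
    ring
  · intro i _ hi
    rw [mul_pow, ← map_pow, coeff_C_mul, coeff_X_pow, if_neg (by omega)]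
    simp
  · simp

lemma substAlgHom_C' {R : Type*} [CommRing R] {y : R⟦X⟧} (hy : HasSubst y) (r : R) :
    (substAlgHom (R := R) hy : R⟦X⟧ →ₐ[R] R⟦X⟧) (C r) = C r :=
  (substAlgHom (R := R) hy).commutes r

/-- Substituting `x / (1 - γ x)` turns the numerator `1 + γ x` into `1 / (1 - γ x)`, so the
transformed quadratic equation has no `γ` term left. -/
lemma mk_binomialTransform_pathSeries {R : Type*} [CommRing R] (α β γ δ : R) :
    (mk (binomialTransform γ fun n => coeff n (pathSeries α β γ δ)) : R⟦X⟧) =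
      pathSeries (α + 2 * γ) (β - α * γ - γ ^ 2) 0 δ := by
  set S : R⟦X⟧ := invOfUnit (1 - C γ * X) 1
  have hS : (1 - C γ * X) * S = 1 := mul_invOfUnit _ _ (by simp)
  have hy : HasSubst (X * S : R⟦X⟧) := HasSubst.of_constantCoeff_zero' (by simp)
  rw [mk_binomialTransform γ _ S hS]
  apply eq_pathSeries
  have h := congrArg (substAlgHom (R := R) hy) (pathSeries_eq α β γ δ)
  simp only [map_add, map_mul, map_pow, map_one, substAlgHom_C', substAlgHom_X,
    coe_substAlgHom] at h
  generalize (pathSeries α β γ δ).subst (X * S) = H at h ⊢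
  have h1 : (1 - C γ * X) * H = 1 + C α * X * H + C β * X ^ 2 * S * H
      + C δ * X ^ 3 * S ^ 2 * H ^ 2 := by
    linear_combination (1 - C γ * X) * h + (C γ * X + C α * X * H + C β * X ^ 2 * S * H +
      C δ * X ^ 3 * S ^ 2 * H ^ 2) * hS
  have h2 : H = S * H * (1 - C γ * X) := by linear_combination -H * hS
  simp only [map_add, map_mul, map_sub, map_pow, map_ofNat, map_zero]
  linear_combination h1 + (C α * X - (1 - C γ * X)) * h2

lemma binomialTransform_pathSeries {R : Type*} [CommRing R] (α β γ δ : R) :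
    (binomialTransform γ fun n => coeff n (pathSeries α β γ δ)) =
      fun n => coeff n (pathSeries (α + 2 * γ) (β - α * γ - γ ^ 2) 0 δ) := by
  funext n
  rw [← mk_binomialTransform_pathSeries, coeff_mk]

lemma vSeq_eq_binomialTransform {R : Type*} [CommRing R] (a b c : R) :
    vSeq a b c = binomialTransform (a - 2 * c + 1) (uSeq a b c) := by
  have h := binomialTransform_pathSeries (2 * (c - 1) - a) (a * (c - 1) - b - (c - 1) ^ 2)
    (a - 2 * c + 1) 1
  unfold uSeq uSeries vSeq vSeries
  rw [h]
  funext n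
  congr 2 <;> ring

/-- The lower triangular matrix of the `r`-th binomial transform. -/
def binomialMatrix {R : Type*} [CommRing R] (r : R) (n : ℕ) : Matrix (Fin n) (Fin n) R :=
  Matrix.of fun i k => (Nat.choose i k : R) * r ^ ((i : ℕ) - k)

lemma det_binomialMatrix {R : Type*} [CommRing R] (r : R) (n : ℕ) :
    (binomialMatrix r n).det = 1 := by
  rw [Matrix.det_of_isLowerTriangular]
  · simp [binomialMatrix]
  · intro i j hij
    have : (i : ℕ) < j := hij
    simp [binomialMatrix, Nat.choose_eq_zero_of_lt this]

/-- Umbrally, let `φ` be the linear functional with `φ (x^m) = s m`. The binomial transform has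
moments `φ ((x + r)^n)`, and `(x + r)^(i+j)` is expanded as a product. -/
lemma binomialTransform_add {R : Type*} [CommRing R] (r : R) (s : ℕ → R) (i j : ℕ) :
    binomialTransform r s (i + j) = ∑ k ∈ Finset.range (i + 1), ∑ l ∈ Finset.range (j + 1),
      (Nat.choose i k : R) * r ^ (i - k) * ((Nat.choose j l : R) * r ^ (j - l)) * s (k + l) := by
  set φ : Polynomial R →ₗ[R] R := Polynomial.lsum fun m => LinearMap.toSpanSingleton R R (s m)
  have hφ (m : ℕ) (c : R) : φ (Polynomial.C c * Polynomial.X ^ m) = c * s m := by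
    rw [Polynomial.C_mul_X_pow_eq_monomial]
    simp [φ, Polynomial.lsum, Polynomial.sum_monomial_index]
  have key (n : ℕ) : (Polynomial.X + Polynomial.C r) ^ n = ∑ k ∈ Finset.range (n + 1),
      Polynomial.C ((Nat.choose n k : R) * r ^ (n - k)) * Polynomial.X ^ k := by
    rw [add_pow]
    refine Finset.sum_congr rfl fun k _ => ?_
    simp only [map_mul, map_pow, map_natCast]
    ring
  have h1 : φ ((Polynomial.X + Polynomial.C r) ^ (i + j)) = binomialTransform r s (i + j) := by
    rw [key, map_sum, binomialTransform]
    exact Finset.sum_congr rfl fun k _ => hφ _ _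
  rw [← h1, pow_add, key, key, Finset.sum_mul_sum, map_sum]
  refine Finset.sum_congr rfl fun k _ => ?_
  rw [map_sum]
  refine Finset.sum_congr rfl fun l _ => ?_
  rw [← hφ]
  congr 1
  simp only [map_mul, pow_add]
  ring

lemma sum_range_choose_extend {R : Type*} [CommRing R] {i N : ℕ} (h : i < N) (r : R)
    (f : ℕ → R) : ∑ k ∈ Finset.range (i + 1), (Nat.choose i k : R) * r ^ (i - k) * f k =
      ∑ k ∈ Finset.range N, (Nat.choose i k : R) * r ^ (i - k) * f k := by
  apply Finset.sum_subset
  · intro x hx; simp at hx ⊢; omega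
  · intro x _ hx
    rw [Nat.choose_eq_zero_of_lt (by simpa using hx)]; simp

/-- The two Hankel matrices are congruent by a unitriangular matrix. -/
lemma hankelTransform_binomialTransform {R : Type*} [CommRing R] (r : R) (s : ℕ → R) :
    hankelTransform (binomialTransform r s) = hankelTransform s := by
  funext n
  have h : (Matrix.of fun i j : Fin (n + 1) => binomialTransform r s ((i : ℕ) + (j : ℕ))) =
      binomialMatrix r (n + 1) * (Matrix.of fun i j : Fin (n + 1) => s ((i : ℕ) + (j : ℕ))) *
        (binomialMatrix r (n + 1)).transpose := by
    ext i j
    rw [Matrix.of_apply, binomialTransform_add, Matrix.mul_assoc, Matrix.mul_apply]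
    simp only [Matrix.mul_apply, binomialMatrix, Matrix.of_apply, Matrix.transpose_apply]
    have e (k : ℕ) : ∑ l ∈ Finset.range ((j : ℕ) + 1), (Nat.choose i k : R) * r ^ ((i : ℕ) - k) *
        ((Nat.choose j l : R) * r ^ ((j : ℕ) - l)) * s (k + l) =
        (Nat.choose i k : R) * r ^ ((i : ℕ) - k) * ∑ l ∈ Finset.range (n + 1),
          (Nat.choose j l : R) * r ^ ((j : ℕ) - l) * s (k + l) := by
      rw [← sum_range_choose_extend j.2, Finset.mul_sum]
      exact Finset.sum_congr rfl fun l _ => by ring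
    simp only [e]
    rw [sum_range_choose_extend i.2, Finset.sum_range]
    refine Finset.sum_congr rfl fun k _ => ?_
    rw [Finset.sum_range]
    congr 1
    exact Finset.sum_congr rfl fun l _ => by ring
  rw [hankelTransform, h, Matrix.det_mul, Matrix.det_mul, Matrix.det_transpose,
    det_binomialMatrix, one_mul, mul_one, hankelTransform]

/-! ### The branch of the curve at the origin and the reversion -/

/-- The tangent at the origin is `y = c x`. With `Y = c x + x² v` the curve becomes a quadratic
equation for `v` of the Catalan type; uniqueness holds since the sum of the roots in `y` is `1 + a
x`, a unit. -/
lemma IsCurveBranch.existsUnique {R : Type*} [CommRing R] (a b c : R) :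
    ∃! Y : R⟦X⟧, IsCurveBranch a b c Y := by
  set Q : R⟦X⟧ := invOfUnit (1 - C (2 * c - a) * X) 1
  have hQ : (1 - C (2 * c - a) * X) * Q = 1 := mul_invOfUnit _ _ (by simp)
  have hv := mul_catalanGF_subst_eq (N := C (c ^ 2 - a * c + b) - X) (t := X ^ 2) hQ (by simp)
  generalize (C (c ^ 2 - a * c + b) - X) * Q *
    (catalanGF R).subst (X ^ 2 * (C (c ^ 2 - a * c + b) - X) * Q ^ 2) = v at hv
  simp only [map_add, map_mul, map_sub, map_pow, map_ofNat] at hv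
  refine ⟨C c * X + X ^ 2 * v, ⟨by simp, ?_⟩, ?_⟩
  · linear_combination -X ^ 2 * hv
  · rintro Z ⟨hZ0, hZ⟩
    have hu : IsUnit (1 + C a * X - (Z + (C c * X + X ^ 2 * v))) := by
      simp [isUnit_iff_constantCoeff, hZ0]
    refine sub_eq_zero.mp ((hu.mul_right_eq_zero).mp ?_)
    linear_combination -hZ - X ^ 2 * hv

lemma branchTransform_subst_eq_X_iff {R : Type*} [CommRing R] (c : R) {Y f : R⟦X⟧}
    (hY : constantCoeff Y = 0) (hf : constantCoeff f = 0) :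
    (branchTransform c Y).subst f = X ↔ f = X * (1 - f - (Y.subst f - C c * f)) := by
  have hs : HasSubst f := HasSubst.of_constantCoeff_zero' hf
  have hV : (1 - X - (Y - C c * X)) * invOfUnit (1 - X - (Y - C c * X)) 1 = 1 :=
    mul_invOfUnit _ _ (by simp [hY])
  have h := congrArg (substAlgHom (R := R) hs) hV
  rw [branchTransform, ← coe_substAlgHom hs]
  simp only [map_sub, map_mul, map_one, substAlgHom_C', substAlgHom_X] at h ⊢
  generalize substAlgHom (R := R) hs (invOfUnit (1 - X - (Y - C c * X)) 1) = U at h ⊢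
  generalize substAlgHom (R := R) hs Y = y at h ⊢
  constructor
  · intro e
    linear_combination (-f) * h + (1 - f - (y - C c * f)) * e
  · intro e
    linear_combination X * h + U * e

lemma isReversion_branchTransform_iff {R : Type*} [CommRing R] {a b c : R} {Y : R⟦X⟧}
    (hY : IsCurveBranch a b c Y) (f : R⟦X⟧) :
    IsReversion (branchTransform c Y) f ↔ f = X * uSeries a b c := by
  obtain ⟨hY0, hY⟩ := hY
  have hcurve (f : R⟦X⟧) (hf : constantCoeff f = 0) :
      (Y.subst f) ^ 2 - C a * f * Y.subst f - Y.subst f = f ^ 3 - C b * f ^ 2 - C c * f := by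
    have hs : HasSubst f := HasSubst.of_constantCoeff_zero' hf
    have h := congrArg (substAlgHom (R := R) hs) hY
    simpa only [map_sub, map_mul, map_pow, substAlgHom_C', substAlgHom_X,
      coe_substAlgHom] using h
  constructor
  · rintro ⟨hf, hF⟩
    rw [branchTransform_subst_eq_X_iff c hY0 hf] at hF
    have hc := hcurve f hf
    have hy0 : constantCoeff (Y.subst f) = 0 := constantCoeff_subst_eq_zero hf _ hY0
    generalize Y.subst f = y at hF hc hy0
    set g := 1 - f - (y - C c * f) with hg
    have hgu : IsUnit g := by simp [isUnit_iff_constantCoeff, hg, hf, hy0]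
    have hy : y = 1 + C c * f - f - g := by rw [hg]; ring
    rw [hF]
    congr 1
    apply eq_pathSeries
    -- With `f = x g` and `y = 1 + (c - 1) f - g`, the curve equation is divisible by `g`, and the
    -- cofactor is the quadratic equation defining `uSeries`.
    have h0 : g * (g - (1 + C (a - 2 * c + 1) * X + C (2 * (c - 1) - a) * X * g
        + C (a * (c - 1) - b - (c - 1) ^ 2) * X ^ 2 * g + C 1 * X ^ 3 * g ^ 2)) = 0 := by
      simp only [map_add, map_mul, map_sub, map_pow, map_ofNat, map_one]
      rw [hy] at hc
      clear_value g
      subst hF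
      linear_combination hc
    exact sub_eq_zero.mp ((hgu.mul_right_eq_zero).mp h0)
  · rintro rfl
    have hg := pathSeries_eq (2 * (c - 1) - a) (a * (c - 1) - b - (c - 1) ^ 2) (a - 2 * c + 1) 1
    change uSeries a b c = _ + _ * uSeries a b c + _ * uSeries a b c + _ * uSeries a b c ^ 2 at hg
    simp only [map_add, map_mul, map_sub, map_pow, map_ofNat, map_one] at hg
    have hg0 : constantCoeff (uSeries a b c) = 1 := by rw [hg]; simp
    have hf : constantCoeff (X * uSeries a b c) = 0 := by simp
    refine ⟨hf, ?_⟩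
    rw [branchTransform_subst_eq_X_iff c hY0 hf]
    have hc := hcurve _ hf
    have hy0 : constantCoeff (Y.subst (X * uSeries a b c)) = 0 :=
      constantCoeff_subst_eq_zero hf _ hY0
    generalize Y.subst (X * uSeries a b c) = y at hc hy0
    generalize uSeries a b c = g at *
    -- Both sides solve the curve equation over `x g` and vanish at `0`, so they are the same root.
    have hy : y = 1 + (C c - 1) * (X * g) - g := by
      have hu : IsUnit (1 + C a * (X * g) - (y + (1 + (C c - 1) * (X * g) - g))) := by
        simp [isUnit_iff_constantCoeff, hy0, hg0]
      refine sub_eq_zero.mp ((hu.mul_right_eq_zero).mp ?_)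
      linear_combination g * hg - hc
    rw [hy]; ring

/-! ### Hankel determinants under one continued fraction step -/

/-- In generating functions: `∑ t (i+j) x^i y^j = t(x) t(y) (1 + b x y ∑ s (k+l) x^k y^l)`. The
induction moves one unit from `j` to `i`. -/
lemma hankel_entry_of_tail {R : Type*} [CommRing R] {a b : R} {t s : ℕ → R} (h0 : t 0 = 1)
    (ht : ∀ n, t (n + 1) = a * t n + b * ∑ k ∈ Finset.range n, t (n - 1 - k) * s k) (i j : ℕ) :
    t (i + j) = t i * t j + b * ∑ k ∈ Finset.range i, t (i - 1 - k) *
      ∑ l ∈ Finset.range j, t (j - 1 - l) * s (k + l) := by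
  induction j generalizing i with
  | zero => simp [h0]
  | succ j ih =>
    rw [show i + (j + 1) = (i + 1) + j by ring, ih, Finset.sum_range_succ']
    simp only [Finset.sum_range_succ' _ j, mul_add, Finset.sum_add_distrib, ht]
    have e1 : ∀ k ∈ Finset.range i, t (i + 1 - 1 - (k + 1)) *
        ∑ l ∈ Finset.range j, t (j - 1 - l) * s (k + 1 + l) = t (i - 1 - k) *
        ∑ l ∈ Finset.range j, t (j + 1 - 1 - (l + 1)) * s (k + (l + 1)) := by
      intro k _
      rw [show i + 1 - 1 - (k + 1) = i - 1 - k by omega]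
      congr 1
      refine Finset.sum_congr rfl fun l _ => ?_
      rw [show j + 1 - 1 - (l + 1) = j - 1 - l by omega, show k + 1 + l = k + (l + 1) by ring]
    rw [Finset.sum_congr rfl e1]
    have e2 : ∑ k ∈ Finset.range i, t (i - 1 - k) * (t (j + 1 - 1 - 0) * s (k + 0)) =
        t j * ∑ k ∈ Finset.range i, t (i - 1 - k) * s k := by
      rw [Finset.mul_sum]
      refine Finset.sum_congr rfl fun k _ => ?_
      simp only [Nat.add_sub_cancel, Nat.sub_zero, Nat.add_zero]; ring
    rw [e2]
    simp only [Nat.add_sub_cancel, Nat.sub_zero, Nat.zero_add]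
    ring

lemma sum_fin_ite_succ_le {R : Type*} [CommRing R] {i n : ℕ} (h : i < n + 2) (t f : ℕ → R) :
    ∑ k : Fin (n + 1), (if (k : ℕ) + 1 ≤ i then t (i - (k + 1)) else 0) * f k =
      ∑ k ∈ Finset.range i, t (i - 1 - k) * f k := by
  rw [← Finset.sum_range (fun k => (if k + 1 ≤ i then t (i - (k + 1)) else 0) * f k)]
  symm
  apply Finset.sum_subset_zero_on_sdiff
  · intro x hx; simp at hx ⊢; omega
  · intro x hx
    simp only [Finset.mem_sdiff, Finset.mem_range] at hx
    rw [if_neg (by omega), zero_mul]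
  · intro x hx
    simp only [Finset.mem_range] at hx
    rw [if_pos (by omega), show i - (x + 1) = i - 1 - x by omega]

/-- One step of a continued fraction expansion acts on Hankel transforms. -/
lemma hankelTransform_succ_of_tail {R : Type*} [CommRing R] {a b : R} {t s : ℕ → R}
    (h0 : t 0 = 1)
    (ht : ∀ n, t (n + 1) = a * t n + b * ∑ k ∈ Finset.range n, t (n - 1 - k) * s k) (n : ℕ) :
    hankelTransform t (n + 1) = b ^ (n + 1) * hankelTransform s n := by
  set T : Matrix (Fin (n + 2)) (Fin (n + 2)) R :=
    Matrix.of fun i k => if (k : ℕ) ≤ i then t (i - k) else 0 with hT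
  set M : Matrix (Fin (n + 2)) (Fin (n + 2)) R := Matrix.of fun k l =>
    Fin.cases (Fin.cases 1 (fun _ => 0) l)
      (fun k' => Fin.cases 0 (fun l' => b * s (k' + l')) l) k with hM
  have hdT : T.det = 1 := by
    rw [Matrix.det_of_isLowerTriangular]
    · simp [hT, h0]
    · intro i j hij
      have : ¬ (j : ℕ) ≤ i := not_le.mpr hij
      simp only [hT, Matrix.of_apply, if_neg this]
  have hdM : M.det = b ^ (n + 1) * hankelTransform s n := by
    rw [Matrix.det_succ_row_zero, Fin.sum_univ_succ]
    have e : M.submatrix Fin.succ (Fin.succAbove 0) =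
        b • (Matrix.of fun i j : Fin (n + 1) => s ((i : ℕ) + (j : ℕ))) := by
      ext i j; simp [hM]
    rw [e, Matrix.det_smul]
    simp [hM, hankelTransform]
  -- `T` is the unitriangular Toeplitz matrix of `t`, and `M` is block diagonal with blocks `1` and
  -- `b` times the Hankel matrix of `s`.
  have h : (Matrix.of fun i j : Fin (n + 2) => t ((i : ℕ) + (j : ℕ))) = T * M * T.transpose := by
    ext i j
    rw [Matrix.of_apply, hankel_entry_of_tail h0 ht, Matrix.mul_assoc, Matrix.mul_apply,
      Fin.sum_univ_succ]
    simp only [Matrix.mul_apply, Matrix.transpose_apply, Fin.sum_univ_succ (n := n + 1)]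
    simp only [hT, hM, Matrix.of_apply, Fin.cases_zero, Fin.cases_succ, Fin.val_zero,
      Fin.val_succ, zero_mul, one_mul, Finset.sum_const_zero, add_zero, zero_add, Nat.zero_le,
      if_true, Nat.sub_zero]
    congr 1
    rw [← sum_fin_ite_succ_le i.2, Finset.mul_sum]
    refine Finset.sum_congr rfl fun k _ => ?_
    rw [← sum_fin_ite_succ_le j.2, mul_left_comm, Finset.mul_sum]
    congr 1
    exact Finset.sum_congr rfl fun l _ => by ring
  rw [hankelTransform, h, Matrix.det_mul, Matrix.det_mul, Matrix.det_transpose, hdT, hdM]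
  ring

lemma hankelTransform_coeff_succ {R : Type*} [CommRing R] {a b : R} {g g' : R⟦X⟧}
    (h : g = 1 + C a * X * g + C b * X ^ 2 * g * g') (n : ℕ) :
    hankelTransform (fun n => coeff n g) (n + 1) =
      b ^ (n + 1) * hankelTransform (fun n => coeff n g') n := by
  refine hankelTransform_succ_of_tail (a := a) ?_ ?_ n
  · rw [h]; simp
  · intro n
    conv_lhs => rw [h]
    rw [show 1 + C a * X * g + C b * X ^ 2 * g * g' =
      1 + X * (C a * g + X * (C b * (g' * g))) by ring, map_add, coeff_one,
      if_neg (Nat.succ_ne_zero n), zero_add, mul_comm X, coeff_succ_mul_X, map_add, coeff_C_mul]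
    congr 1
    cases n with
    | zero => simp
    | succ n =>
      rw [mul_comm X, coeff_succ_mul_X, coeff_C_mul, coeff_mul,
        Finset.Nat.sum_antidiagonal_eq_sum_range_succ_mk]
      congr 1
      refine Finset.sum_congr rfl fun k hk => ?_
      simp only [Nat.add_sub_cancel]; ring

/-! ### The family of tails of the continued fraction -/

/-- The solution `g` of
`x²(b + (δ - b(w + p))x) g² - (1 - p x + (2 b - q) x²) g + 1 + w x = 0`. -/
noncomputable def tailSeries {R : Type*} [CommRing R] (p q δ b w : R) : R⟦X⟧ :=
  (1 + C w * X) * quadInv p (q - 2 * b) *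
    (catalanGF R).subst (X ^ 2 * (C b + C (δ - b * (w + p)) * X) * (1 + C w * X) *
      quadInv p (q - 2 * b) ^ 2)

lemma tailSeries_eq {R : Type*} [CommRing R] (p q δ b w : R) :
    (1 - C p * X - C (q - 2 * b) * X ^ 2) * tailSeries p q δ b w =
      (1 + C w * X) + X ^ 2 * (C b + C (δ - b * (w + p)) * X) * tailSeries p q δ b w ^ 2 :=
  mul_catalanGF_subst_eq (quadInv_spec _ _) (by simp)

lemma pathSeries_eq_tailSeries {R : Type*} [CommRing R] (p q δ : R) :
    pathSeries p q 0 δ = tailSeries p q δ 0 0 := by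
  symm
  apply eq_pathSeries
  have h := tailSeries_eq p q δ 0 0
  simp only [map_zero, mul_zero, zero_mul, sub_zero, zero_add, add_zero] at h ⊢
  linear_combination h

/-- The family is closed under `g = 1 / (1 - (w + p) x - b' x² g')`: inserting this into the
quadratic equation of `g` gives that of `g'` exactly when `b'` and `w'` are related to `b` and `w`
as assumed. -/
lemma tailSeries_step {R : Type*} [CommRing R] {p q δ b w b' w' : R}
    (hb : b' = q - w ^ 2 - p * w - b) (hw : b' * (w + w' + p) = δ) :
    tailSeries p q δ b w = 1 + C (w + p) * X * tailSeries p q δ b w +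
      C b' * X ^ 2 * tailSeries p q δ b w * tailSeries p q δ b' w' := by
  have h' := tailSeries_eq p q δ b' w'
  generalize tailSeries p q δ b' w' = g' at h' ⊢
  set e : R⟦X⟧ := 1 - C (w + p) * X - C b' * X ^ 2 * g'
  have he : e * invOfUnit e 1 = 1 := mul_invOfUnit _ _ (by simp [e])
  have hg : tailSeries p q δ b w = invOfUnit e 1 := by
    refine eq_of_quadratic (by simp) (by simp) (tailSeries_eq p q δ b w) ?_
    generalize invOfUnit e 1 = E at he ⊢
    -- This is the quadratic equation for `1 / e`, multiplied by `e²`.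
    have key : X ^ 2 * (C b + C (δ - b * (w + p)) * X) -
        (1 - C p * X - C (q - 2 * b) * X ^ 2) * e + (1 + C w * X) * e ^ 2 = 0 := by
      obtain rfl : q = b' + w ^ 2 + p * w + b := by rw [hb]; ring
      rw [← hw] at h' ⊢
      simp only [e, map_add, map_mul, map_sub, map_pow, map_ofNat] at h' ⊢
      linear_combination (-C b' * X ^ 2) * h'
    linear_combination (-E ^ 2) * key - (1 - C p * X - C (q - 2 * b) * X ^ 2) * E * he +
      (1 + C w * X) * (e * E + 1) * he
  rw [hg]
  simp only [e] at he
  linear_combination he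

/-- The parameters of the continued fraction expansion of `pathSeries p q 0 δ`. -/
structure IsTailSequence {R : Type*} [CommRing R] (p q δ : R) (b w : ℕ → R) : Prop where
  b_zero : b 0 = 0
  w_zero : w 0 = 0
  b_succ : ∀ k, b (k + 1) = q - w k ^ 2 - p * w k - b k
  mul_eq : ∀ k, b (k + 1) * (w k + w (k + 1) + p) = δ

/-- The Hankel transform of the coefficients of `tailSeries`. -/
noncomputable def tailHankel {R : Type*} [CommRing R] (p q δ b w : R) : ℕ → R :=
  hankelTransform fun n => coeff n (tailSeries p q δ b w)

lemma tailSeries_eq_X_mul {R : Type*} [CommRing R] (p q δ b w : R) :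
    tailSeries p q δ b w = 1 + X * (C w + C p * tailSeries p q δ b w +
      X * (C (q - 2 * b) * tailSeries p q δ b w +
        (C b * tailSeries p q δ b w ^ 2 +
          X * (C (δ - b * (w + p)) * tailSeries p q δ b w ^ 2)))) := by
  linear_combination tailSeries_eq p q δ b w

lemma coeff_tailSeries {R : Type*} [CommRing R] (p q δ b w : R) :
    coeff 0 (tailSeries p q δ b w) = 1 ∧ coeff 1 (tailSeries p q δ b w) = w + p ∧
      coeff 2 (tailSeries p q δ b w) = p * (w + p) + q - b := by
  have h := tailSeries_eq_X_mul p q δ b w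
  generalize tailSeries p q δ b w = g at h ⊢
  have cX (n : ℕ) (f : R⟦X⟧) : coeff (n + 1) (X * f) = coeff n f := by
    rw [mul_comm, coeff_succ_mul_X]
  have h0 : coeff 0 g = 1 := by rw [h]; simp
  have h1 : coeff 1 g = w + p := by
    rw [h, map_add, cX 0, map_add, map_add, coeff_C_mul, h0]; simp [coeff_one]
  refine ⟨h0, h1, ?_⟩
  have h0' : constantCoeff g = 1 := by simpa using h0
  rw [h, map_add, cX 1, map_add, map_add, coeff_C_mul, h1, cX 0]
  simp [coeff_one, h0']
  ring

lemma tailHankel_zero {R : Type*} [CommRing R] (p q δ b w : R) :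
    tailHankel p q δ b w 0 = 1 := by
  simpa [tailHankel, hankelTransform] using (coeff_tailSeries p q δ b w).1

lemma tailHankel_one {R : Type*} [CommRing R] (p q δ b w : R) :
    tailHankel p q δ b w 1 = q - w ^ 2 - p * w - b := by
  obtain ⟨h0, h1, h2⟩ := coeff_tailSeries p q δ b w
  rw [tailHankel, hankelTransform, Matrix.det_fin_two]
  simp only [Matrix.of_apply, Fin.val_zero, Fin.val_one, add_zero, zero_add]
  rw [h0, h1, h2]; ring

lemma tailHankel_succ {R : Type*} [CommRing R] {p q δ b w b' w' : R}
    (hb : b' = q - w ^ 2 - p * w - b) (hw : b' * (w + w' + p) = δ) (n : ℕ) :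
    tailHankel p q δ b w (n + 1) = b' ^ (n + 1) * tailHankel p q δ b' w' n :=
  hankelTransform_coeff_succ (tailSeries_step hb hw) n

/-! ### Invariants of the recursion and the Somos-4 relation -/

namespace IsTailSequence

variable {R : Type*} [CommRing R] {p q δ : R} {b w : ℕ → R}

lemma hankel_succ (h : IsTailSequence p q δ b w) (k n : ℕ) :
    tailHankel p q δ (b k) (w k) (n + 1) =
      b (k + 1) ^ (n + 1) * tailHankel p q δ (b (k + 1)) (w (k + 1)) n :=
  tailHankel_succ (h.b_succ k) (h.mul_eq k) n

lemma hankel_mul_hankel (h : IsTailSequence p q δ b w) (k n : ℕ) :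
    tailHankel p q δ (b k) (w k) (n + 2) * tailHankel p q δ (b k) (w k) n =
      b (k + n + 2) * tailHankel p q δ (b k) (w k) (n + 1) ^ 2 := by
  induction n generalizing k with
  | zero =>
    rw [h.hankel_succ k 1, h.hankel_succ (k + 1) 0, h.hankel_succ k 0]
    simp only [tailHankel_zero]
    ring
  | succ n ih =>
    rw [h.hankel_succ k (n + 2), h.hankel_succ k n, h.hankel_succ k (n + 1)]
    have := ih (k + 1)
    rw [show k + 1 + n + 2 = k + (n + 1) + 2 by ring] at this
    linear_combination b (k + 1) ^ (n + 3) * b (k + 1) ^ (n + 1) * this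

lemma hankel_ne_zero [IsDomain R] (h : IsTailSequence p q δ b w) (hb : ∀ k, b (k + 1) ≠ 0)
    (k n : ℕ) : tailHankel p q δ (b k) (w k) n ≠ 0 := by
  induction n generalizing k with
  | zero => simp [tailHankel_zero]
  | succ n ih =>
    rw [h.hankel_succ]
    exact mul_ne_zero (pow_ne_zero _ (hb k)) (ih _)

/-- The first relation says that the quadratic equations of all tails have the same discriminant `(1
- p x - q x²)² - 4 δ x³`. The second is carried along in the induction and needs cancellation of `b
(k + 1)`. -/
lemma invariants [IsDomain R] (h : IsTailSequence p q δ b w) (hb : ∀ k, b (k + 1) ≠ 0) (k : ℕ) :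
    b k * b (k + 1) = -δ * w k ∧ b (k + 1) = q + w k * w (k + 1) := by
  induction k with
  | zero => rw [h.b_succ]; simp [h.b_zero, h.w_zero]
  | succ k ih =>
    obtain ⟨-, h2⟩ := ih
    have e1 : b (k + 1) * b (k + 2) = -δ * w (k + 1) := by
      rw [h.b_succ (k + 1)]
      linear_combination (-w (k + 1)) * h.mul_eq k - b (k + 1) * h2
    refine ⟨e1, ?_⟩
    apply mul_left_cancel₀ (hb (k + 1))
    linear_combination (-w (k + 1)) * h.mul_eq (k + 1) - e1 + b (k + 2) * h.b_succ (k + 1)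

lemma b_mul_b_sq_mul_b [IsDomain R] (h : IsTailSequence p q δ b w) (hb : ∀ k, b (k + 1) ≠ 0)
    (k : ℕ) : b k * b (k + 1) ^ 2 * b (k + 2) = δ ^ 2 * (b (k + 1) - q) := by
  have h1 := h.invariants hb k
  have h2 := (h.invariants hb (k + 1)).1
  linear_combination b (k + 1) * b (k + 2) * h1.1 + (-δ * w k) * h2 - δ ^ 2 * h1.2

lemma isSomosFour [IsDomain R] (h : IsTailSequence p q δ b w) (hb : ∀ k, b (k + 1) ≠ 0) :
    IsSomosFour (δ ^ 2) (-(δ ^ 2 * q)) (tailHankel p q δ 0 0) := by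
  intro n
  have hn := h.hankel_mul_hankel 0
  have h0 := h.hankel_ne_zero hb 0 (n + 2)
  simp only [h.b_zero, h.w_zero, zero_add] at hn h0
  have e0 := hn n
  have e1 := hn (n + 1)
  have e2 := hn (n + 2)
  have e := h.b_mul_b_sq_mul_b hb (n + 2)
  generalize tailHankel p q δ 0 0 = H at *
  simp only [add_assoc, Nat.reduceAdd] at *
  -- By `hankel_mul_hankel`, `H (n+3) H (n+1) / H (n+2)²` is `b (n+3)` and `H (n+4) H n / H (n+2)²`
  -- is `b (n+2) b (n+3)² b (n+4)`; `e` relates the two.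
  apply mul_right_cancel₀ (pow_ne_zero 2 h0)
  linear_combination H (n + 2) * H n * e2 + b (n + 4) * H (n + 3) ^ 2 * e0 +
    b (n + 4) * b (n + 2) * (H (n + 3) * H (n + 1) + b (n + 3) * H (n + 2) ^ 2) * e1
    + H (n + 2) ^ 4 * e - δ ^ 2 * H (n + 2) ^ 2 * e1

end IsTailSequence

/-! ### Genericity and transfer to arbitrary rings -/

lemma exists_isTailSequence {K : Type*} [Field K] {p q δ : K}
    (h : ∀ n, tailHankel p q δ 0 0 n ≠ 0) :
    ∃ b w : ℕ → K, IsTailSequence p q δ b w ∧ ∀ k, b (k + 1) ≠ 0 := by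
  -- The recursion solved for the next pair. The divisor is the Hankel determinant of order two of
  -- the current tail (`tailHankel_one`), and nonvanishing passes from each tail to the next.
  let F : K × K → K × K := fun x =>
    (q - x.2 ^ 2 - p * x.2 - x.1, δ / (q - x.2 ^ 2 - p * x.2 - x.1) - x.2 - p)
  let s : ℕ → K × K := fun k => F^[k] (0, 0)
  have hs (k : ℕ) : s (k + 1) = F (s k) := Function.iterate_succ_apply' F k (0, 0)
  have hb (k : ℕ) : (s (k + 1)).1 = q - (s k).2 ^ 2 - p * (s k).2 - (s k).1 := by rw [hs]
  have hw (k : ℕ) (hk : (s (k + 1)).1 ≠ 0) :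
      (s (k + 1)).1 * ((s k).2 + (s (k + 1)).2 + p) = δ := by
    have : (s (k + 1)).2 = δ / (s (k + 1)).1 - (s k).2 - p := by rw [hb, hs]
    rw [this]; field_simp; ring
  have hne (k : ℕ) : ∀ n, tailHankel p q δ (s k).1 (s k).2 n ≠ 0 := by
    induction k with
    | zero => exact h
    | succ k ih =>
      intro n
      have h1 : (s (k + 1)).1 ≠ 0 := by
        have := ih 1
        rwa [tailHankel_one, ← hb] at this
      have := ih (n + 1)
      rw [tailHankel_succ (hb k) (hw k h1)] at this
      exact right_ne_zero_of_mul this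
  have hb0 (k : ℕ) : (s (k + 1)).1 ≠ 0 := by
    have := hne k 1
    rwa [tailHankel_one, ← hb] at this
  exact ⟨fun k => (s k).1, fun k => (s k).2, ⟨rfl, rfl, hb, fun k => hw k (hb0 k)⟩, hb0⟩

lemma map_pathArray {R S : Type*} [CommRing R] [CommRing S] (f : R →+* S) (α β γ δ : R)
    (n k : ℕ) : f (pathArray α β γ δ n k) = pathArray (f α) (f β) (f γ) (f δ) n k := by
  induction n using Nat.strong_induction_on generalizing k with
  | _ n ih =>
  match n, k, ih with
  | 0, 0, _ => simp [pathArray]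
  | 0, k + 1, _ => simp [pathArray]
  | 1, 0, _ => simp [pathArray]
  | 1, 1, _ => simp [pathArray]
  | 1, k + 2, _ => simp [pathArray]
  | n + 2, 0, ih =>
    simp only [pathArray, map_add, map_mul, ih n (by omega), ih (n + 1) (by omega)]
  | n + 2, k + 1, ih =>
    simp only [pathArray, map_add, map_mul, ih n (by omega), ih (n + 1) (by omega)]

lemma coeff_pathSeries {R : Type*} [CommRing R] (α β γ δ : R) (n : ℕ) :
    coeff n (pathSeries α β γ δ) = pathArray α β γ δ n 0 := by
  rw [pathArray_eq_coeff, pow_zero, mul_one]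

lemma tailHankel_zero_zero {R : Type*} [CommRing R] (p q δ : R) :
    tailHankel p q δ 0 0 = hankelTransform fun n => coeff n (pathSeries p q 0 δ) := by
  rw [tailHankel, pathSeries_eq_tailSeries]

lemma map_tailHankel {R S : Type*} [CommRing R] [CommRing S] (f : R →+* S) (p q δ : R) (n : ℕ) :
    f (tailHankel p q δ 0 0 n) = tailHankel (f p) (f q) (f δ) 0 0 n := by
  rw [tailHankel_zero_zero, tailHankel_zero_zero, hankelTransform, hankelTransform,
    RingHom.map_det]
  congr 1
  ext i j
  simp [coeff_pathSeries, map_pathArray]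

/-- The parameters make the cubic `1 + 2 p x + (p² + 4 q) x² + 4 x³` equal to `(1 + 2 l x)³`. The
curve is then cuspidal, with additive group, so the recursion has a solution rational in `k`, with
`b k > 0` for `k > 0`. -/
lemma exists_real_tailHankel_ne_zero :
    ∃ p q : ℝ, ∀ n, tailHankel p q 1 0 0 n ≠ 0 := by
  obtain ⟨l, hl⟩ : ∃ l : ℝ, l ^ 3 = 1 / 2 :=
    ⟨(1 / 2) ^ (1 / 3 : ℝ), by rw [← Real.rpow_natCast, ← Real.rpow_mul (by norm_num)]; norm_num⟩
  have hl0 : l ≠ 0 := by rintro rfl; norm_num at hl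
  set b : ℕ → ℝ := fun k => k * (k + 2) / (k + 1) ^ 2 * l ^ 2 with hb
  set w : ℕ → ℝ := fun k => -(k * (k + 3) / (2 * (k + 1) * (k + 2))) * l with hw
  have h : IsTailSequence (3 * l) (3 / 4 * l ^ 2) 1 b w := by
    refine ⟨by simp [hb], by simp [hw], fun k => ?_, fun k => ?_⟩
    · simp only [hb, hw]; push_cast
      have h1 : (k : ℝ) + 1 ≠ 0 := by positivity
      have h2 : (k : ℝ) + 2 ≠ 0 := by positivity
      have h3 : (k : ℝ) + 1 + 1 ≠ 0 := by positivity
      field_simp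
      ring
    · simp only [hb, hw]; push_cast
      have h1 : (k : ℝ) + 1 ≠ 0 := by positivity
      have h2 : (k : ℝ) + 2 ≠ 0 := by positivity
      have h3 : (k : ℝ) + 3 ≠ 0 := by positivity
      have h4 : (k : ℝ) + 1 + 1 ≠ 0 := by positivity
      have h5 : (k : ℝ) + 1 + 2 ≠ 0 := by positivity
      calc _ = 2 * l ^ 3 := by field_simp; ring
        _ = 1 := by rw [hl]; norm_num
  refine ⟨3 * l, 3 / 4 * l ^ 2, fun n => ?_⟩
  have := h.hankel_ne_zero (fun k => by simp only [hb]; push_cast; positivity) 0 n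
  rwa [h.b_zero, h.w_zero] at this

lemma isSomosFour_tailHankel {R : Type*} [CommRing R] (p q δ : R) :
    IsSomosFour (δ ^ 2) (-(δ ^ 2 * q)) (tailHankel p q δ 0 0) := by
  let A := MvPolynomial (Fin 3) ℤ
  let x : Fin 3 → A := MvPolynomial.X
  have hA (n : ℕ) : tailHankel (x 0) (x 1) (x 2) 0 0 n ≠ 0 := by
    obtain ⟨p, q, h⟩ := exists_real_tailHankel_ne_zero
    intro h0
    have := congrArg (MvPolynomial.eval₂Hom (Int.castRingHom ℝ) ![p, q, 1]) h0
    rw [map_tailHankel] at this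
    simp only [x, MvPolynomial.eval₂Hom_X', map_zero] at this
    exact h n this
  let ι : A →+* FractionRing A := algebraMap A (FractionRing A)
  have hι : Function.Injective ι := IsFractionRing.injective A (FractionRing A)
  obtain ⟨b, w, h, hb⟩ := exists_isTailSequence (p := ι (x 0)) (q := ι (x 1)) (δ := ι (x 2))
    (fun n => by rw [← map_tailHankel]; exact (map_ne_zero_iff ι hι).mpr (hA n))
  intro n
  have h1 := h.isSomosFour hb n
  simp only [← map_tailHankel, ← map_mul, ← map_pow, ← map_add, ← map_neg] at h1
  -- The identity now holds among polynomials with integer coefficients, so it specializes to every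
  -- commutative ring.
  have h2 := congrArg (MvPolynomial.eval₂Hom (Int.castRingHom R) ![p, q, δ]) (hι h1)
  simp only [map_mul, map_pow, map_add, map_neg, map_tailHankel, x, MvPolynomial.eval₂Hom_X'] at h2
  exact h2

/-! ### Multiples of the point on the curve -/

/-- The product of the `x`-coordinates of the sum and of the difference of two points. -/
lemma slope_product_identity {R : Type*} [CommRing R] {a b c x₁ y₁ x₂ y₂ : R}
    (h₁ : y₁ ^ 2 - a * x₁ * y₁ - y₁ = x₁ ^ 3 - b * x₁ ^ 2 - c * x₁)
    (h₂ : y₂ ^ 2 - a * x₂ * y₂ - y₂ = x₂ ^ 3 - b * x₂ ^ 2 - c * x₂) :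
    ((y₁ - y₂) ^ 2 - a * (y₁ - y₂) * (x₁ - x₂) + (b - x₁ - x₂) * (x₁ - x₂) ^ 2) *
      ((y₁ + y₂ - a * x₂ - 1) ^ 2 - a * (y₁ + y₂ - a * x₂ - 1) * (x₁ - x₂)
        + (b - x₁ - x₂) * (x₁ - x₂) ^ 2) =
    (x₁ - x₂) ^ 2 * (x₁ ^ 2 * x₂ ^ 2 - (a - 2 * c) * x₁ * x₂ - (x₁ + x₂)
      - (a * c - b - c ^ 2)) := by
  linear_combination ((y₁ - y₂) * (y₁ + y₂ - a * x₂ - 1)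
    + (x₁ ^ 3 - b * x₁ ^ 2 - c * x₁ - (x₂ ^ 3 - b * x₂ ^ 2 - c * x₂) + a * (x₁ - x₂) * y₁)
    - a * (x₁ - x₂) * (2 * y₁ - a * x₂ - 1) - 2 * (b - x₁ - x₂) * (x₁ - x₂) ^ 2
    + a ^ 2 * (x₁ - x₂) ^ 2) * (h₁ - h₂)
    + (4 * (b - x₁ - x₂) * (x₁ - x₂) ^ 2 - a ^ 2 * (x₁ - x₂) ^ 2) * h₁

lemma equation_somosCurve_iff {R : Type*} [CommRing R] (a b c x y : R) :
    (somosCurve a b c).toAffine.Equation x y ↔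
      y ^ 2 - a * x * y - y = x ^ 3 - b * x ^ 2 - c * x := by
  rw [WeierstrassCurve.Affine.equation_iff]
  simp only [somosCurve]
  constructor <;> intro h <;> linear_combination h

section Point

open WeierstrassCurve.Affine

variable {K : Type*} [Field K] {a b c : K}

lemma some_eq_some_of_eq {W : WeierstrassCurve.Affine K} {x y x' y' : K} (h : W.Nonsingular x y)
    (hx : x = x') (hy : y = y') :
    ∃ h' : W.Nonsingular x' y', Point.some x y h = Point.some x' y' h' := by
  subst hx hy; exact ⟨h, rfl⟩

lemma addX_mul_addX_sub [DecidableEq K] {x₁ y₁ x₂ y₂ x₃ y₃ x₄ y₄ : K} (hx : x₁ ≠ x₂)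
    {h₁ : (somosCurve a b c).toAffine.Nonsingular x₁ y₁}
    {h₂ : (somosCurve a b c).toAffine.Nonsingular x₂ y₂}
    {h₃ : (somosCurve a b c).toAffine.Nonsingular x₃ y₃}
    {h₄ : (somosCurve a b c).toAffine.Nonsingular x₄ y₄}
    (hadd : Point.some _ _ h₁ + Point.some _ _ h₂ = Point.some _ _ h₃)
    (hsub : Point.some _ _ h₁ - Point.some _ _ h₂ = Point.some _ _ h₄) :
    x₃ * x₄ * (x₁ - x₂) ^ 2 = x₁ ^ 2 * x₂ ^ 2 - (a - 2 * c) * x₁ * x₂ - (x₁ + x₂)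
      - (a * c - b - c ^ 2) := by
  have hd : x₁ - x₂ ≠ 0 := sub_ne_zero.mpr hx
  rw [Point.add_of_X_ne hx, Point.some.injEq] at hadd
  rw [sub_eq_add_neg, Point.neg_some, Point.add_of_X_ne hx, Point.some.injEq] at hsub
  obtain ⟨e₃, -⟩ := hadd
  obtain ⟨e₄, -⟩ := hsub
  rw [slope_of_X_ne hx] at e₃ e₄
  simp only [addX, negY, somosCurve] at e₃ e₄
  have k₃ : x₃ * (x₁ - x₂) ^ 2 = (y₁ - y₂) ^ 2 - a * (y₁ - y₂) * (x₁ - x₂)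
      + (b - x₁ - x₂) * (x₁ - x₂) ^ 2 := by
    rw [← e₃]; field_simp; ring
  have k₄ : x₄ * (x₁ - x₂) ^ 2 = (y₁ + y₂ - a * x₂ - 1) ^ 2
      - a * (y₁ + y₂ - a * x₂ - 1) * (x₁ - x₂) + (b - x₁ - x₂) * (x₁ - x₂) ^ 2 := by
    rw [← e₄]; field_simp; ring
  have key := slope_product_identity ((equation_somosCurve_iff a b c x₁ y₁).mp h₁.1)
    ((equation_somosCurve_iff a b c x₂ y₂).mp h₂.1)
  rw [← k₃, ← k₄] at key
  apply mul_left_cancel₀ (pow_ne_zero 2 hd)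
  linear_combination key

/-- Adding `P = (0,0)` along a line of slope `c - w k` reproduces the recursion: `b_succ` is the
formula for the new `x`-coordinate and `mul_eq` that for the new `y`-coordinate. -/
lemma exists_nsmul_eq_some [DecidableEq K] {B w : ℕ → K}
    (h : IsTailSequence (a - 2 * c) (a * c - b - c ^ 2) 1 B w) (hB : ∀ k, B (k + 1) ≠ 0)
    (h₀ : (somosCurve a b c).toAffine.Nonsingular 0 0) (k : ℕ) :
    ∃ h' : (somosCurve a b c).toAffine.Nonsingular (-B k) (-B k * (c - w k)),
      (k + 1) • Point.some _ _ h₀ = Point.some _ _ h' := by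
  induction k with
  | zero =>
    rw [zero_add, one_smul]
    exact some_eq_some_of_eq h₀ (by rw [h.b_zero, neg_zero]) (by rw [h.b_zero]; ring)
  | succ k ih =>
    obtain ⟨h', ih⟩ := ih
    -- The addition is isolated from the computation of the slope, which is that of the tangent for
    -- `k = 0`, where `B 0 = 0`, and that of a chord otherwise.
    have hs : ∀ {x y : K} (hp : (somosCurve a b c).toAffine.Nonsingular x y),
        x = -B k → y = -B k * (c - w k) →
        (x = 0 → y ≠ (somosCurve a b c).toAffine.negY 0 0) →
        (somosCurve a b c).toAffine.slope x 0 y 0 = c - w k →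
        ∃ h' : (somosCurve a b c).toAffine.Nonsingular (-B (k + 1))
          (-B (k + 1) * (c - w (k + 1))),
          Point.some _ _ hp + Point.some _ _ h₀ = Point.some _ _ h' := by
      intro x y hp hx hy hne hl
      rw [Point.add_some (fun hxy => hne hxy.1 hxy.2)]
      have hX : (somosCurve a b c).toAffine.addX x 0
          ((somosCurve a b c).toAffine.slope x 0 y 0) = -B (k + 1) := by
        rw [hl, hx, h.b_succ]
        simp only [addX, somosCurve]
        ring
      refine some_eq_some_of_eq _ hX ?_
      rw [addY, negAddY, hX, hl, negY, hx, hy]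
      simp only [somosCurve]
      linear_combination -h.mul_eq k
    rw [succ_nsmul, ih]
    refine hs h' rfl rfl ?_ ?_
    · intro h0
      rw [h0]
      simp [negY, somosCurve]
    · cases k with
      | zero =>
        simp only [h.b_zero, h.w_zero, neg_zero, zero_mul, sub_zero]
        rw [slope_of_Y_ne rfl (by simp [negY, somosCurve])]
        simp [negY, somosCurve]
      | succ k =>
        rw [slope_of_X_ne (neg_ne_zero.mpr (hB k))]
        rw [sub_zero, sub_zero, mul_div_cancel_left₀ _ (neg_ne_zero.mpr (hB k))]

lemma nonsingular_somosCurve_zero : (somosCurve a b c).toAffine.Nonsingular 0 0 := by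
  rw [WeierstrassCurve.Affine.nonsingular_iff]
  refine ⟨(equation_somosCurve_iff a b c 0 0).mpr (by ring), Or.inr ?_⟩
  simp [somosCurve]

end Point

/-! ### Ward's identity and elliptic divisibility sequences -/

/-- Ward's identity for a sequence attached to the multiples of a point with `x`-coordinates `x`. -/
lemma mul_eq_sub_mul_of_addition {K : Type*} [Field K] {W x : ℕ → K} {p q : K}
    (hW0 : W 0 = 0) (hW1 : W 1 = 1) (hW2 : W 2 ^ 2 = 1) (hW : ∀ n, W (n + 1) ≠ 0)
    (hx1 : x 1 = 0) (hx2 : x 2 = -q)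
    (hrec : ∀ n, W (n + 2) * W n = -x (n + 1) * W (n + 1) ^ 2)
    (hadd : ∀ n j, x (n + 1 + (j + 1)) ≠ x (n + 1) →
      x (2 * (n + 1) + (j + 1)) * x (j + 1) * (x (n + 1 + (j + 1)) - x (n + 1)) ^ 2 =
        x (n + 1 + (j + 1)) ^ 2 * x (n + 1) ^ 2 - p * x (n + 1 + (j + 1)) * x (n + 1)
          - (x (n + 1 + (j + 1)) + x (n + 1)) - q)
    (hone : ∀ n ξ, (ξ - x (n + 3)) * (ξ - x (n + 1)) * x (n + 2) ^ 2 =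
      ξ ^ 2 * x (n + 2) ^ 2 - p * ξ * x (n + 2) - (ξ + x (n + 2)) - q) (n : ℕ) :
    ∀ j, W (2 * (n + 1) + j) * W j =
      (x (n + 1) - x (n + 1 + j)) * W (n + 1 + j) ^ 2 * W (n + 1) ^ 2 := by
  induction n using Nat.twoStepInduction with
  | zero =>
    intro j
    have := hrec j
    rw [show 2 * (0 + 1) + j = j + 2 by ring, show 0 + 1 + j = j + 1 by ring, hW1, hx1]
    linear_combination this
  | one =>
    intro j
    cases j with
    | zero => simp [hW0]
    | succ j =>
      rw [show 2 * (1 + 1) + (j + 1) = j + 5 by ring, show 1 + 1 + (j + 1) = j + 3 by ring,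
        show 1 + 1 = 2 by rfl, hW2, hx2]
      have e1 := hrec (j + 3)
      have e2 := hrec (j + 1)
      have e3 := hrec (j + 2)
      -- At `ξ = 0` this reads `x (j+4) x (j+2) x (j+3)² = x 2 - x (j+3)`, since `x 2 = -q`.
      have e4 := hone (j + 1) 0
      simp only [add_assoc, Nat.reduceAdd] at e1 e2 e3 e4
      apply mul_right_cancel₀ (pow_ne_zero 2 (hW (j + 2)))
      simp only [add_assoc, Nat.reduceAdd]
      linear_combination W (j + 3) * W (j + 1) * e1 - x (j + 4) * W (j + 4) ^ 2 * e2 +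
        x (j + 4) * x (j + 2) * (W (j + 4) * W (j + 2) - x (j + 3) * W (j + 3) ^ 2) * e3 +
        W (j + 3) ^ 4 * e4
  | more n ih1 ih2 =>
    intro j
    cases j with
    | zero => simp [hW0]
    | succ j =>
      -- Put `m = n + j + 4`, `N = n + 2`. The shifts in `j` keep `m` fixed, so the hypotheses
      -- concern `W (m+N-1) W (m-N+1)` and `W (m+N) W (m-N)`, and the goal `W (m+N+1) W (m-N-1)`.
      have f1 := ih1 (j + 3)
      have f2 := ih2 (j + 2)
      have e1 := hrec (2 * n + j + 5)
      have e2 := hrec (j + 1)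
      have e3 := hrec (n + 1)
      have e4 := hone n (x (n + j + 4))
      have e5 := hadd (n + 1) (j + 1)
      simp only [show 2 * (n + 1) + (j + 3) = 2 * n + j + 5 by ring,
        show n + 1 + (j + 3) = n + j + 4 by ring] at f1
      simp only [show 2 * (n + 1 + 1) + (j + 2) = 2 * n + j + 6 by ring,
        show n + 1 + 1 + (j + 2) = n + j + 4 by ring] at f2
      simp only [show 2 * (n + 1 + 1) + (j + 1 + 1) = 2 * n + j + 6 by ring,
        show n + 1 + 1 + (j + 1 + 1) = n + j + 4 by ring] at e5
      rw [show 2 * (n + 2 + 1) + (j + 1) = 2 * n + j + 7 by ring,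
        show n + 2 + 1 + (j + 1) = n + j + 4 by ring]
      simp only [add_assoc, Nat.reduceAdd] at *
      -- Equal `x`-coordinates would make the nonzero product in `f2` vanish, so the addition law
      -- for distinct abscissas applies.
      have hne : x (n + (j + 4)) ≠ x (n + 2) := by
        intro h
        rw [h, sub_self, zero_mul, zero_mul] at f2
        exact mul_ne_zero (hW (2 * n + (j + 5))) (hW (j + 1)) f2
      have e5 := e5 hne
      have h0 : W (2 * n + (j + 5)) * W (j + 3) ≠ 0 :=
        mul_ne_zero (hW (2 * n + (j + 4))) (hW (j + 2))
      apply mul_right_cancel₀ h0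
      generalize x (n + (j + 4)) = ξ at *
      generalize W (n + (j + 4)) = ω at *
      have g1 : W (2 * n + (j + 7)) * W (j + 1) * (W (2 * n + (j + 5)) * W (j + 3)) =
          x (2 * n + (j + 6)) * x (j + 2) * (W (2 * n + (j + 6)) * W (j + 2)) ^ 2 := by
        linear_combination W (j + 3) * W (j + 1) * e1
          - x (2 * n + (j + 6)) * W (2 * n + (j + 6)) ^ 2 * e2
      rw [g1, f1, f2]
      -- The addition law `e5` and `e4` have the same right-hand side; hence `x (m+N) x (m-N) (x m -
      -- x N)² = (x m - x (N+1)) (x m - x (N-1)) x N²`.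
      linear_combination ω ^ 4 * W (n + 2) ^ 4 * (e5 - e4)
        - (x (n + 3) - ξ) * (x (n + 1) - ξ) * ω ^ 4 *
          (W (n + 3) * W (n + 1) - x (n + 2) * W (n + 2) ^ 2) * e3

/-- Ward's identity with index differences `2` and `1` gives the even and odd duplication formulas
once `hrec` eliminates the `x`-coordinates. -/
lemma eq_normEDS_of_mul_eq {K : Type*} [Field K] {W x : ℕ → K} {q d : K}
    (hW0 : W 0 = 0) (hW1 : W 1 = 1) (hW2 : W 2 = -1) (hW3 : W 3 = q) (hW4 : W 4 = -d)
    (hrec : ∀ n, W (n + 2) * W n = -x (n + 1) * W (n + 1) ^ 2)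
    (h : ∀ n j, W (2 * (n + 1) + j) * W j =
      (x (n + 1) - x (n + 1 + j)) * W (n + 1 + j) ^ 2 * W (n + 1) ^ 2) (n : ℕ) :
    W n = normEDS (-1) q d n := by
  induction n using normEDSRec with
  | zero => simp [hW0]
  | one => simp [hW1]
  | two => simp [hW2]
  | three => simp [hW3]
  | four => simp [hW4]
  | even m i1 i2 i3 i4 i5 =>
    have e := normEDS_even (-1) q d ((m : ℤ) + 3)
    rw [show (m : ℤ) + 3 - 1 = ((m + 2 : ℕ) : ℤ) by push_cast; ring,
      show (m : ℤ) + 3 - 2 = ((m + 1 : ℕ) : ℤ) by push_cast; ring,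
      show (m : ℤ) + 3 + 2 = ((m + 5 : ℕ) : ℤ) by push_cast; ring,
      show (m : ℤ) + 3 + 1 = ((m + 4 : ℕ) : ℤ) by push_cast; ring,
      show 2 * ((m : ℤ) + 3) = ((2 * (m + 3) : ℕ) : ℤ) by push_cast; ring,
      show (m : ℤ) + 3 = ((m + 3 : ℕ) : ℤ) by push_cast; ring, ← i1, ← i2, ← i3, ← i4, ← i5] at e
    have f := h (m + 1) 2
    rw [show 2 * (m + 1 + 1) + 2 = 2 * (m + 3) by ring, hW2] at f
    have r1 := hrec (m + 1)
    have r2 := hrec (m + 3)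
    simp only [add_assoc, Nat.reduceAdd] at f r1 r2
    linear_combination e - f - W (m + 4) ^ 2 * r1 + W (m + 2) ^ 2 * r2
  | odd m i1 i2 i3 i4 =>
    have e := normEDS_odd (-1) q d ((m : ℤ) + 2)
    rw [show (m : ℤ) + 2 - 1 = ((m + 1 : ℕ) : ℤ) by push_cast; ring,
      show (m : ℤ) + 2 + 2 = ((m + 4 : ℕ) : ℤ) by push_cast; ring,
      show (m : ℤ) + 2 + 1 = ((m + 3 : ℕ) : ℤ) by push_cast; ring,
      show 2 * ((m : ℤ) + 2) + 1 = ((2 * (m + 2) + 1 : ℕ) : ℤ) by push_cast; ring,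
      show (m : ℤ) + 2 = ((m + 2 : ℕ) : ℤ) by push_cast; ring, ← i1, ← i2, ← i3, ← i4] at e
    have f := h (m + 1) 1
    rw [show 2 * (m + 1 + 1) + 1 = 2 * (m + 2) + 1 by ring, hW1] at f
    have r1 := hrec (m + 1)
    have r2 := hrec (m + 2)
    simp only [add_assoc, Nat.reduceAdd] at f r1 r2
    rw [e]
    linear_combination f + W (m + 3) ^ 2 * r1 - W (m + 2) ^ 2 * r2

/-- The sequence `0, 1, -h 0, h 1, -h 2, …`. -/
def shiftedSign {R : Type*} [CommRing R] (h : ℕ → R) : ℕ → R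
  | 0 => 0
  | 1 => 1
  | n + 2 => (-1) ^ (n + 1) * h n

namespace IsTailSequence

variable {K : Type*} [Field K] {a b c : K} {B w : ℕ → K}

lemma shiftedSign_rec {p q δ : K} (h : IsTailSequence p q δ B w) (n : ℕ) :
    shiftedSign (tailHankel p q δ 0 0) (n + 2) * shiftedSign (tailHankel p q δ 0 0) n =
      B n * shiftedSign (tailHankel p q δ 0 0) (n + 1) ^ 2 := by
  match n with
  | 0 => simp [shiftedSign, h.b_zero]
  | 1 => simp [shiftedSign, tailHankel_zero, tailHankel_one, h.b_succ, h.b_zero, h.w_zero]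
  | n + 2 =>
    have := h.hankel_mul_hankel 0 n
    rw [h.b_zero, h.w_zero, zero_add] at this
    simp only [shiftedSign]
    have e : ((-1 : K) ^ (n + 1)) ^ 2 = 1 := by rw [← pow_mul, mul_comm, pow_mul]; simp
    linear_combination (-1) ^ (n + 1) * (-1) ^ (n + 3) * this

lemma shiftedSign_ne_zero {p q δ : K} (h : IsTailSequence p q δ B w) (hB : ∀ k, B (k + 1) ≠ 0)
    (n : ℕ) : shiftedSign (tailHankel p q δ 0 0) (n + 1) ≠ 0 := by
  cases n with
  | zero => exact one_ne_zero
  | succ n =>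
    have := h.hankel_ne_zero hB 0 n
    rw [h.b_zero, h.w_zero] at this
    exact mul_ne_zero (pow_ne_zero _ (neg_ne_zero.mpr one_ne_zero)) this

lemma addition (h : IsTailSequence (a - 2 * c) (a * c - b - c ^ 2) 1 B w)
    (hB : ∀ k, B (k + 1) ≠ 0) (n j : ℕ) (hne : -B (n + j + 1) ≠ -B n) :
    -B (2 * n + j + 2) * -B j * (-B (n + j + 1) - -B n) ^ 2 =
      (-B (n + j + 1)) ^ 2 * (-B n) ^ 2 - (a - 2 * c) * -B (n + j + 1) * -B n
        - (-B (n + j + 1) + -B n) - (a * c - b - c ^ 2) := by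
  classical
  have h₀ : (somosCurve a b c).toAffine.Nonsingular 0 0 := nonsingular_somosCurve_zero
  obtain ⟨h₁, e₁⟩ := exists_nsmul_eq_some h hB h₀ (n + j + 1)
  obtain ⟨h₂, e₂⟩ := exists_nsmul_eq_some h hB h₀ n
  obtain ⟨h₃, e₃⟩ := exists_nsmul_eq_some h hB h₀ (2 * n + j + 2)
  obtain ⟨h₄, e₄⟩ := exists_nsmul_eq_some h hB h₀ j
  refine addX_mul_addX_sub hne (h₁ := h₁) (h₂ := h₂) (h₃ := h₃) (h₄ := h₄) ?_ ?_
  · rw [← e₁, ← e₂, ← e₃, ← add_nsmul]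
    congr 1; ring
  · rw [← e₁, ← e₂, ← e₄, sub_eq_iff_eq_add, ← add_nsmul]
    congr 1; ring

/-- The right-hand side of the addition law, as a quadratic in `ξ`, has as roots the abscissas of
the two neighbouring multiples, because `P` has abscissa `0`. The coefficients are compared by means
of the invariants. -/
lemma addition_one {p q : K} (h : IsTailSequence p q 1 B w) (hB : ∀ k, B (k + 1) ≠ 0)
    (n : ℕ) (ξ : K) : (ξ - -B (n + 2)) * (ξ - -B n) * (-B (n + 1)) ^ 2 =
      ξ ^ 2 * (-B (n + 1)) ^ 2 - p * ξ * -B (n + 1) - (ξ + -B (n + 1)) - q := by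
  have h1 := h.b_mul_b_sq_mul_b hB n
  have h2 := (h.invariants hB n).1
  have h3 := (h.invariants hB (n + 1)).1
  have h4 := h.mul_eq n
  linear_combination h1 + ξ * B (n + 1) * (h2 + h3) - ξ * h4

lemma shiftedSign_eq_normEDS (h : IsTailSequence (a - 2 * c) (a * c - b - c ^ 2) 1 B w)
    (hB : ∀ k, B (k + 1) ≠ 0) (n : ℕ) :
    shiftedSign (tailHankel (a - 2 * c) (a * c - b - c ^ 2) 1 0 0) n =
      normEDS (-1) (a * c - b - c ^ 2) ((a - 2 * c) * (a * c - b - c ^ 2) - 1) n := by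
  have hrec := h.shiftedSign_rec
  have hne := h.shiftedSign_ne_zero hB
  have hb1 : B 1 = a * c - b - c ^ 2 := by rw [h.b_succ, h.b_zero, h.w_zero]; ring
  have hb12 := (h.invariants hB 1).1
  have hw1 := h.mul_eq 0
  have hr2 := hrec 2
  set W := shiftedSign (tailHankel (a - 2 * c) (a * c - b - c ^ 2) 1 0 0) with hW
  have hW2 : W 2 = -1 := by simp [hW, shiftedSign, tailHankel_zero]
  have hW3 : W 3 = a * c - b - c ^ 2 := by
    simp [hW, shiftedSign, tailHankel_one]
  have hW4 : W 4 = -((a - 2 * c) * (a * c - b - c ^ 2) - 1) := by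
    rw [hW2, hW3] at hr2
    rw [h.w_zero] at hw1
    simp only [zero_add, Nat.reduceAdd] at hr2 hb12 hw1
    rw [hb1] at hw1 hb12
    linear_combination -hr2 - (a * c - b - c ^ 2) * hb12 + hw1
  -- `-B (n - 1)` is the abscissa of `n P` for `n ≥ 1`; the truncated value at `n = 0` is never
  -- used.
  have hrec' : ∀ n, W (n + 2) * W n = -(fun n => -B (n - 1)) (n + 1) * W (n + 1) ^ 2 := by
    intro n; simpa using hrec n
  refine eq_normEDS_of_mul_eq (x := fun n => -B (n - 1)) rfl rfl hW2 hW3 hW4 hrec' ?_ n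
  refine mul_eq_sub_mul_of_addition (x := fun n => -B (n - 1)) (p := a - 2 * c) (q := a * c - b - c ^ 2) rfl rfl
    (by rw [hW2]; norm_num) hne (by simp [h.b_zero]) (by simp [hb1]) hrec' ?_ ?_
  · intro n j hxy
    simp only [show n + 1 + (j + 1) - 1 = n + j + 1 by omega, Nat.add_sub_cancel,
      show 2 * (n + 1) + (j + 1) - 1 = 2 * n + j + 2 by omega] at hxy ⊢
    exact h.addition hB n j hxy
  · intro n ξ
    exact h.addition_one hB n ξ

end IsTailSequence

lemma tailHankel_eq_normEDS {R : Type*} [CommRing R] (a b c : R) (n : ℕ) :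
    tailHankel (a - 2 * c) (a * c - b - c ^ 2) 1 0 0 n = (-1) ^ (n + 1) *
      normEDS (-1) (a * c - b - c ^ 2) ((a - 2 * c) * (a * c - b - c ^ 2) - 1) ((n : ℤ) + 2) := by
  let A := MvPolynomial (Fin 3) ℤ
  let x : Fin 3 → A := MvPolynomial.X
  have hA (n : ℕ) : tailHankel (x 0 - 2 * x 2) (x 0 * x 2 - x 1 - x 2 ^ 2) 1 0 0 n ≠ 0 := by
    obtain ⟨p, q, h⟩ := exists_real_tailHankel_ne_zero
    intro h0
    -- For `(a, b, c) = (p, -q, 0)` the parameters `a - 2c` and `ac - b - c²` become `p` and `q`.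
    have := congrArg (MvPolynomial.eval₂Hom (Int.castRingHom ℝ) ![p, -q, 0]) h0
    rw [map_tailHankel] at this
    simp only [x, MvPolynomial.eval₂Hom_X', map_zero, map_sub, map_mul, map_pow, map_one,
      map_ofNat] at this
    exact h n (by simpa using this)
  let ι : A →+* FractionRing A := algebraMap A (FractionRing A)
  have hι : Function.Injective ι := IsFractionRing.injective A (FractionRing A)
  obtain ⟨B, w, h, hB⟩ := exists_isTailSequence (p := ι (x 0) - 2 * ι (x 2))
    (q := ι (x 0) * ι (x 2) - ι (x 1) - ι (x 2) ^ 2) (δ := 1) (fun n => by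
      have := (map_ne_zero_iff ι hι).mpr (hA n)
      rw [map_tailHankel] at this
      simpa only [map_sub, map_mul, map_pow, map_one, map_ofNat] using this)
  have h1 := h.shiftedSign_eq_normEDS hB (n + 2)
  have h2 : ι (tailHankel (x 0 - 2 * x 2) (x 0 * x 2 - x 1 - x 2 ^ 2) 1 0 0 n) =
      ι ((-1) ^ (n + 1) * normEDS (-1) (x 0 * x 2 - x 1 - x 2 ^ 2)
        ((x 0 - 2 * x 2) * (x 0 * x 2 - x 1 - x 2 ^ 2) - 1) ((n : ℤ) + 2)) := by
    simp only [map_tailHankel, map_mul, map_normEDS, map_sub, map_pow, map_one, map_ofNat,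
      map_neg]
    push_cast at h1
    rw [← h1, shiftedSign, ← mul_assoc, ← mul_pow]
    simp
  have h3 := congrArg (MvPolynomial.eval₂Hom (Int.castRingHom R) ![a, b, c]) (hι h2)
  simp only [map_tailHankel, map_mul, map_normEDS, map_sub, map_pow, map_one, map_ofNat,
    map_neg, x, MvPolynomial.eval₂Hom_X'] at h3
  exact h3

lemma ellipticDivisibilitySeq_somosCurve {R : Type*} [CommRing R] (a b c : R) (n : ℤ) :
    ellipticDivisibilitySeq (somosCurve a b c) 0 0 n =
      normEDS (-1) (a * c - b - c ^ 2) ((a - 2 * c) * (a * c - b - c ^ 2) - 1) n := by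
  rw [ellipticDivisibilitySeq, WeierstrassCurve.ψ, ← Polynomial.coe_evalEvalRingHom,
    map_normEDS]
  congr 1
  · simp [WeierstrassCurve.ψ₂, WeierstrassCurve.Affine.polynomialY, somosCurve]
  · simp [WeierstrassCurve.Ψ₃, somosCurve, WeierstrassCurve.b₂,
      WeierstrassCurve.b₄, WeierstrassCurve.b₆, WeierstrassCurve.b₈]
    ring
  · simp [WeierstrassCurve.preΨ₄, somosCurve, WeierstrassCurve.b₂,
      WeierstrassCurve.b₄, WeierstrassCurve.b₆, WeierstrassCurve.b₈]
    ring

/-! ### Reduction to `γ = 0` and conclusion -/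

lemma hankelTransform_pathSeries {R : Type*} [CommRing R] (α β γ δ : R) :
    hankelTransform (fun n => coeff n (pathSeries α β γ δ)) =
      tailHankel (α + 2 * γ) (β - α * γ - γ ^ 2) δ 0 0 := by
  rw [tailHankel_zero_zero, ← binomialTransform_pathSeries, hankelTransform_binomialTransform]

lemma isSomosFour_pathSeries {R : Type*} [CommRing R] (α β γ δ : R) :
    IsSomosFour (δ ^ 2) (δ ^ 2 * (α * γ - β + γ ^ 2))
      (hankelTransform fun n => coeff n (pathSeries α β γ δ)) := by
  rw [hankelTransform_pathSeries]
  convert isSomosFour_tailHankel (α + 2 * γ) (β - α * γ - γ ^ 2) δ using 1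
  ring

lemma hankelTransform_vSeq {R : Type*} [CommRing R] (a b c : R) :
    hankelTransform (vSeq a b c) = tailHankel (a - 2 * c) (a * c - b - c ^ 2) 1 0 0 :=
  (tailHankel_zero_zero _ _ _).symm

theorem mainTheorem2 {R : Type*} [CommRing R] :
    -- binomial transforms leave Hankel transforms unchanged
    (∀ (r : R) (s : ℕ → R), hankelTransform (binomialTransform r s) = hankelTransform s) ∧
    -- the sequences attached to the curve `y^2 - a x y - y = x^3 - b x^2 - c x`
    (∀ a b c : R,
      -- `x g(x)` is the reversion of the series built from the branch of the curve at `(0,0)`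
      ((∃! Y : R⟦X⟧, IsCurveBranch a b c Y) ∧
        ∀ Y : R⟦X⟧, IsCurveBranch a b c Y →
          ∀ f : R⟦X⟧, IsReversion (branchTransform c Y) f ↔ f = X * uSeries a b c) ∧
      -- explicit forms of `u_n` and `v_n`; `v` is a binomial transform of `u`
      (∀ n, uSeq a b c n =
        uFormula (2 * (c - 1) - a) (a * (c - 1) - b - (c - 1) ^ 2) (a - 2 * c + 1) n) ∧
      (∀ n, vSeq a b c n = vFormula (a - 2 * c) (a * c - b - c ^ 2) n) ∧
      vSeq a b c = binomialTransform (a - 2 * c + 1) (uSeq a b c) ∧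
      -- they enumerate the lattice paths from `(0,0)` to `(n,0)` with the associated step sets
      (∀ n, uSeq a b c n =
        pathArray (2 * (c - 1) - a) (a * (c - 1) - b - (c - 1) ^ 2) (a - 2 * c + 1) 1 n 0) ∧
      (∀ n, vSeq a b c n = pathArray (a - 2 * c) (a * c - b - c ^ 2) 0 1 n 0) ∧
      -- `u` and `v` have the same Hankel transform, and its first terms
      hankelTransform (vSeq a b c) = hankelTransform (uSeq a b c) ∧
      hankelTransform (uSeq a b c) 0 = 1 ∧
      hankelTransform (uSeq a b c) 1 = a * c - b - c ^ 2 ∧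
      hankelTransform (uSeq a b c) 2 =
        a ^ 2 * c - a * (b + 3 * c ^ 2) + 2 * b * c + 2 * c ^ 3 - 1 ∧
      -- it is a Somos-4 sequence
      IsSomosFour 1 (-(a * c) + b + c ^ 2) (hankelTransform (uSeq a b c)) ∧
      IsSomosFour 1 (-(a * c) + b + c ^ 2) (hankelTransform (vSeq a b c)) ∧
      -- it is the elliptic divisibility sequence of the curve at `P = (0,0)`, up to a shift and sign
      (somosCurve a b c).toAffine.Equation 0 0 ∧
      (∀ n : ℕ, hankelTransform (uSeq a b c) n =
        (-1) ^ (n + 1) * ellipticDivisibilitySeq (somosCurve a b c) 0 0 ((n : ℤ) + 2)) ∧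
      (∀ n : ℕ, hankelTransform (vSeq a b c) n =
        (-1) ^ (n + 1) * ellipticDivisibilitySeq (somosCurve a b c) 0 0 ((n : ℤ) + 2))) ∧
    -- the general recurrence with parameters `α, β, γ, δ`
    (∀ α β γ δ : R,
      -- `x g(x)` is the solution `u` of `u / x = 1 + γ x + α u + β u x + δ u^2 x`
      (∀ f : R⟦X⟧,
        f = X * (1 + C γ * X + C α * f + C β * f * X + C δ * f ^ 2 * X) ↔
          f = X * pathSeries α β γ δ) ∧
      -- the array `t_{n,k}` of the recurrence is the Riordan array `(g(x), x g(x))`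
      (∀ n k : ℕ, pathArray α β γ δ n k =
        PowerSeries.coeff n (pathSeries α β γ δ * (X * pathSeries α β γ δ) ^ k)) ∧
      -- the Hankel transform of the expansion of `g(x)` is a Somos-4 sequence
      IsSomosFour (δ ^ 2) (δ ^ 2 * (α * γ - β + γ ^ 2))
        (hankelTransform fun n => PowerSeries.coeff n (pathSeries α β γ δ))) := by
  refine ⟨hankelTransform_binomialTransform, fun a b c => ?_, fun α β γ δ =>
    ⟨eq_X_mul_pathSeries_iff α β γ δ, pathArray_eq_coeff α β γ δ,
      isSomosFour_pathSeries α β γ δ⟩⟩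
  have huv : hankelTransform (vSeq a b c) = hankelTransform (uSeq a b c) := by
    rw [vSeq_eq_binomialTransform, hankelTransform_binomialTransform]
  have hv := hankelTransform_vSeq a b c
  have hsomos : IsSomosFour 1 (-(a * c) + b + c ^ 2) (hankelTransform (vSeq a b c)) := by
    convert isSomosFour_tailHankel (a - 2 * c) (a * c - b - c ^ 2) 1 using 1 <;> ring
  have heds (n : ℕ) : hankelTransform (vSeq a b c) n =
      (-1) ^ (n + 1) * ellipticDivisibilitySeq (somosCurve a b c) 0 0 ((n : ℤ) + 2) := by
    rw [hv, tailHankel_eq_normEDS, ellipticDivisibilitySeq_somosCurve]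
  have h2 : tailHankel (a - 2 * c) (a * c - b - c ^ 2) 1 0 0 2 =
      a ^ 2 * c - a * (b + 3 * c ^ 2) + 2 * b * c + 2 * c ^ 3 - 1 := by
    -- The third Hankel determinant is read off from the fourth term of the divisibility sequence.
    rw [tailHankel_eq_normEDS, show ((2 : ℕ) : ℤ) + 2 = 4 by norm_num, normEDS_four]
    ring
  refine ⟨⟨IsCurveBranch.existsUnique a b c, fun Y hY => isReversion_branchTransform_iff hY⟩,
    coeff_pathSeries_one _ _ _, fun n => ?_, vSeq_eq_binomialTransform a b c,
    coeff_pathSeries _ _ _ _, coeff_pathSeries _ _ _ _, huv, ?_, ?_, ?_, huv ▸ hsomos, hsomos,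
    (equation_somosCurve_iff a b c 0 0).mpr (by ring), huv ▸ heds, heds⟩
  · rw [← uFormula_zero]
    exact coeff_pathSeries_one _ _ _ n
  · rw [← huv, hv, tailHankel_zero]
  · rw [← huv, hv, tailHankel_one]; ring
  · rw [← huv, hv, h2]
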